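/- Let $M\subseteq\mathbb R^3$ be a smooth $3$-dimensional submanifold with boundary (without corners), let $\mathcal S\subseteq M$, and let $\mathcal O_3=O(3)/\mathcal B_3$ be the space of undirected orthonormal $3$-frames, where $\mathcal B_3$ is the group of signed permutation matrices. A $3$-frame field on $M$ with singularity set $\mathcal S$ is a continuous map $f\colon M\setminus\mathcal S\to\mathcal O_3$; it is boundary aligned if at each point of $\partial M\setminus\mathcal S$ one axis of the frame is normal to $\partial M$. A singularity graph $G$ of $f$ is a subspace $G\subseteq\mathcal S$ that is a topological graph (possibly infinite, locally finite) whose closed edges are smoothly embedded copies of $[0,1]$; we assume that $G$ is relatively open in $\mathcal S$ (for example $G=\mathcal S$). A leaf is a vertex incident to exactly one edge. A branch is an edge having at least one leaf, together with those of its endpoints that are leaves and without its endpoint that is not a leaf, if there is one. A set $U\subseteq\mathcal S$ is redundant if there are a relatively closed subset $B\subseteq M$ and a frame field $f'\colon (M\setminus\mathcal S)\cup \operatorname{Int}_M(B)\to\mathcal O_3$ such that $U\subseteq\operatorname{Int}_M(B)$ and $f'=f$ on $(M\setminus\mathcal S)\setminus\operatorname{Int}_M(B)$, with $f'$ boundary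 aligned whenever $f$ is. Here $\operatorname{Int}_M(B)$ is the interior of $B$ as a subspace of $M$. Then every branch $L$ of $G$ with $L\cap\partial M=\emptyset$ is redundant. Moreover the redefinition is local: for every open set $W\subseteq\mathbb R^3$ containing the closure $\overline L$, the set $B$ can be chosen inside $W$. -/

import Mathlib

open Set Topology
open scoped ContDiff

/-- The full hyperoctahedral group `B_n` inside `O(n)`: the matrices obtained from the identity
matrix by permuting its columns and changing the signs of some of them. -/
def hyperoctahedralGroup (n : ℕ) : Subgroup (Matrix.orthogonalGroup (Fin n) ℝ) where
  carrier := {A | ∃ (σ : Equiv.Perm (Fin n)) (ε : Fin n → ℤˣ),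
    ∀ i j, (A : Matrix (Fin n) (Fin n) ℝ) i j = if i = σ j then ((ε j : ℤ) : ℝ) else 0}
  one_mem' := ⟨1, 1, fun i j => by simp [Matrix.one_apply]⟩
  mul_mem' := by
    rintro A B ⟨σ, ε, hA⟩ ⟨τ, δ, hB⟩
    refine ⟨σ * τ, fun j => ε (τ j) * δ j, fun i j => ?_⟩
    have h : ((A * B : Matrix.orthogonalGroup (Fin n) ℝ) : Matrix (Fin n) (Fin n) ℝ) i j
        = ∑ k, (A : Matrix (Fin n) (Fin n) ℝ) i k * (B : Matrix (Fin n) (Fin n) ℝ) k j := rfl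
    rw [h, Finset.sum_eq_single (τ j)]
    · rw [hA, hB]
      by_cases hi : i = σ (τ j) <;> simp [hi]
    · intro k _ hk
      rw [hB, if_neg hk, mul_zero]
    · intro hk
      exact absurd (Finset.mem_univ _) hk
  inv_mem' := by
    rintro A ⟨σ, ε, hA⟩
    refine ⟨σ⁻¹, fun j => ε (σ⁻¹ j), fun i j => ?_⟩
    have h : ((A⁻¹ : Matrix.orthogonalGroup (Fin n) ℝ) : Matrix (Fin n) (Fin n) ℝ) i j
        = (A : Matrix (Fin n) (Fin n) ℝ) j i := rfl
    rw [h, hA]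
    by_cases hj : j = σ i
    · subst hj
      simp
    · have hi : i ≠ σ⁻¹ j := fun h => hj (by simp [h])
      rw [if_neg hj, if_neg hi]

/-- The space `O_n = O(n) / B_n` of undirected orthonormal `n`-frames in `ℝⁿ`, with the quotient
topology. The group `B_n` acts on the right, so it permutes and reflects the columns, which are
the axes of the frame. -/
abbrev FrameSpace (n : ℕ) : Type :=
  Matrix.orthogonalGroup (Fin n) ℝ ⧸ hyperoctahedralGroup n

/-- The line spanned by `v` is one of the axes of the undirected frame `q`. -/
def IsUnitAxis {n : ℕ} (q : FrameSpace n) (v : EuclideanSpace ℝ (Fin n)) : Prop :=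
  ∃ A : Matrix.orthogonalGroup (Fin n) ℝ, (QuotientGroup.mk A : FrameSpace n) = q ∧
    ∃ j, ∀ i, v i = (A : Matrix (Fin n) (Fin n) ℝ) i j

/-- The boundary of a codimension `0` submanifold `M` of `ℝⁿ`: the points of `M` that are not
interior. -/
def manifoldBoundary {n : ℕ} (M : Set (EuclideanSpace ℝ (Fin n))) :
    Set (EuclideanSpace ℝ (Fin n)) :=
  M \ interior M

/-- `M` is a smooth `n`-dimensional submanifold with boundary (and without corners) of `ℝⁿ`:
near a boundary point it is the region `0 ≤ φ` of a smooth function `φ` with nonzero derivative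
at that point. Near the other points of `M` there is nothing to require. -/
def IsSmoothDomain {n : ℕ} (M : Set (EuclideanSpace ℝ (Fin n))) : Prop :=
  ∀ x ∈ manifoldBoundary M, ∃ (U : Set (EuclideanSpace ℝ (Fin n)))
    (φ : EuclideanSpace ℝ (Fin n) → ℝ), IsOpen U ∧ x ∈ U ∧ ContDiffOn ℝ ∞ φ U ∧
      fderiv ℝ φ x ≠ 0 ∧ M ∩ U = {y ∈ U | 0 ≤ φ y}

/-- An undirected `n`-frame field on `M ⊆ ℝⁿ` with singularity set `S`: a continuous map
`M \ S → O_n`. The values of `f` outside `M \ S` carry no meaning. -/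
def IsFrameField {n : ℕ} (M S : Set (EuclideanSpace ℝ (Fin n)))
    (f : EuclideanSpace ℝ (Fin n) → FrameSpace n) : Prop :=
  ContinuousOn f (M \ S)

/-- The frame field `f` on `M` with singularity set `S` is boundary aligned: at each boundary
point where it is defined, one of its axes is normal to the tangent space of the boundary. -/
def IsBoundaryAligned {n : ℕ} (M S : Set (EuclideanSpace ℝ (Fin n)))
    (f : EuclideanSpace ℝ (Fin n) → FrameSpace n) : Prop :=
  ∀ x ∈ manifoldBoundary M \ S, ∃ v, IsUnitAxis (f x) v ∧
    ∀ w ∈ tangentConeAt ℝ (manifoldBoundary M) x, inner ℝ v w = 0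

/-- The interior of `B` as a subspace of `M`. -/
def relInterior {n : ℕ} (M B : Set (EuclideanSpace ℝ (Fin n))) :
    Set (EuclideanSpace ℝ (Fin n)) :=
  {x ∈ M | B ∈ 𝓝[M] x}

/-- The set `U` of singularities of the frame field `f` on `M \ S` is redundant, and this is
witnessed by a modification of `f` inside `W`: there are a subset `B` of `M ∩ W`, closed in `M`,
and a frame field `f'` on `(M \ S) ∪ Int_M(B)` such that `U ⊆ Int_M(B)` and `f'` agrees
with `f` on `(M \ S) \ Int_M(B)`; if `f` is boundary aligned, then so is `f'`.
The singularity set of `f'` is `S \ Int_M(B)`. -/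
def IsRedundantWithin {n : ℕ} (M S : Set (EuclideanSpace ℝ (Fin n)))
    (f : EuclideanSpace ℝ (Fin n) → FrameSpace n) (U W : Set (EuclideanSpace ℝ (Fin n))) : Prop :=
  ∃ (B : Set (EuclideanSpace ℝ (Fin n))) (f' : EuclideanSpace ℝ (Fin n) → FrameSpace n),
    B ⊆ M ∩ W ∧ IsClosed ((↑) ⁻¹' B : Set M) ∧
      IsFrameField M (S \ relInterior M B) f' ∧
      U ⊆ relInterior M B ∧
      EqOn f' f ((M \ S) \ relInterior M B) ∧
      (IsBoundaryAligned M S f → IsBoundaryAligned M (S \ relInterior M B) f')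

/-- The set `U` of singularities of the frame field `f` on `M \ S` is redundant. -/
def IsRedundant {n : ℕ} (M S : Set (EuclideanSpace ℝ (Fin n)))
    (f : EuclideanSpace ℝ (Fin n) → FrameSpace n) (U : Set (EuclideanSpace ℝ (Fin n))) : Prop :=
  IsRedundantWithin M S f U univ

/-- A singularity graph in the singularity set `S`, with edges indexed by `ι`: a subspace of `S`
that is a topological graph whose closed edges are smooth submanifolds homeomorphic to `[0,1]`.
Each closed edge is given by a smooth regular parametrization on `[0,1]`; `locally_finite` says
that the subspace topology is the topology of the graph. -/
structure SingularityGraph {n : ℕ} (S : Set (EuclideanSpace ℝ (Fin n))) (ι : Type*) where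
  /-- the vertices -/
  vertices : Set (EuclideanSpace ℝ (Fin n))
  /-- the parametrizations of the edges -/
  edge : ι → ℝ → EuclideanSpace ℝ (Fin n)
  vertices_subset : vertices ⊆ S
  edge_subset : ∀ e, edge e '' Icc 0 1 ⊆ S
  contDiffOn_edge : ∀ e, ContDiffOn ℝ ∞ (edge e) (Icc 0 1)
  injOn_edge : ∀ e, InjOn (edge e) (Icc 0 1)
  derivWithin_edge_ne_zero : ∀ e, ∀ t ∈ Icc (0 : ℝ) 1, derivWithin (edge e) (Icc 0 1) t ≠ 0
  edge_zero_mem : ∀ e, edge e 0 ∈ vertices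
  edge_one_mem : ∀ e, edge e 1 ∈ vertices
  disjoint_vertices : ∀ e, Disjoint (edge e '' Ioo 0 1) vertices
  disjoint_edges : ∀ e e', e ≠ e' → Disjoint (edge e '' Ioo 0 1) (edge e' '' Ioo 0 1)
  locally_finite : ∀ x ∈ vertices ∪ ⋃ e, edge e '' Icc 0 1, ∃ U ∈ 𝓝 x,
    (vertices ∩ U).Finite ∧ {e | (edge e '' Icc 0 1 ∩ U).Nonempty}.Finite

namespace SingularityGraph

variable {n : ℕ} {S : Set (EuclideanSpace ℝ (Fin n))} {ι : Type*}

/-- The closed edge `e`. -/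
def closedEdge (G : SingularityGraph S ι) (e : ι) : Set (EuclideanSpace ℝ (Fin n)) :=
  G.edge e '' Icc 0 1

/-- The underlying subspace of the graph. -/
def carrier (G : SingularityGraph S ι) : Set (EuclideanSpace ℝ (Fin n)) :=
  G.vertices ∪ ⋃ e, G.closedEdge e

/-- A leaf is a vertex that is incident to exactly one edge. -/
def IsLeaf (G : SingularityGraph S ι) (v : EuclideanSpace ℝ (Fin n)) : Prop :=
  v ∈ G.vertices ∧ ∃! e, v ∈ G.closedEdge e

/-- A branch is an edge with at least one leaf vertex, and with those of its vertices removed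
that are not leaves. -/
def IsBranch (G : SingularityGraph S ι) (L : Set (EuclideanSpace ℝ (Fin n))) : Prop :=
  ∃ e, (∃ v ∈ G.closedEdge e, G.IsLeaf v) ∧
    L = G.closedEdge e \ {v | v ∈ G.vertices ∧ ¬ G.IsLeaf v}

end SingularityGraph

/-!
Pushing a singular arc along itself towards one of its end points removes it without any homotopy
theory. For an embedded arc `γ : [0, 1] → ℝ³` and a thin neighbourhood `V` of `γ [0, 1)` there
is a continuous map `ρ` from the complement of `γ 1` to the complement of the arc that is the
identity off `V` (`IsTameArc.exists_retraction`): topologically, `V` contains a closed half-space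
with `γ [0, 1)` inside, and a half-space retracts onto its boundary. Then `f ∘ ρ` is a frame field
that agrees with `f` off `V` and is singular on the arc at most at `γ 1`. Smoothness of the edges
enters only through the fact that an edge is locally a graph over a line (`IsTameArc`), so that
short pieces of it can be pushed explicitly (`IsTameArc.exists_canPushOff_near`).

If the edge has exactly one leaf, parametrize it such that `γ 0` is the leaf. The vertex `γ 1`
does not belong to the branch, the neighbourhood can be chosen to shrink to `γ 1`, and it does not
matter that `f ∘ ρ` is undefined there (`isRedundantWithin_image_Ico`).

If both vertices are leaves, `f ∘ ρ` has a point singularity at `γ 1` left, which is removed by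
extending the field from a small sphere around `γ 1` to the ball (`isRedundantWithin_image_Icc`).
This is possible because `π₂(O(3) / B₃) = 0` (`exists_frame_extension_closedBall`): the unit
quaternions `S³` cover the space of frames (`isCoveringMap_frameOfQuaternion`), maps of the
sphere `S²` lift to `S³` (`IsCoveringMap.exists_lift_sphere`), and a map `S² → S³` is close to a
smooth map, which misses a direction and so is homotopic to a constant
(`exists_ne_zero_extension_closedBall`).
-/

/-! ### The covering of the space of frames by the unit quaternions -/

section Covering

open scoped Quaternion

/-- The rotation matrix of a quaternion. For a unit quaternion `q` it is the matrix of
`v ↦ q v q⁻¹` on the imaginary quaternions. -/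
def rotationMatrix (q : ℍ[ℝ]) : Matrix (Fin 3) (Fin 3) ℝ :=
  !![q.re ^ 2 + q.imI ^ 2 - q.imJ ^ 2 - q.imK ^ 2, 2 * (q.imI * q.imJ - q.re * q.imK),
      2 * (q.imI * q.imK + q.re * q.imJ);
    2 * (q.imI * q.imJ + q.re * q.imK), q.re ^ 2 - q.imI ^ 2 + q.imJ ^ 2 - q.imK ^ 2,
      2 * (q.imJ * q.imK - q.re * q.imI);
    2 * (q.imI * q.imK - q.re * q.imJ), 2 * (q.imJ * q.imK + q.re * q.imI),
      q.re ^ 2 - q.imI ^ 2 - q.imJ ^ 2 + q.imK ^ 2]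

/-- The group of unit quaternions. -/
abbrev UnitQuaternion : Type := Metric.sphere (0 : Quaternion ℝ) 1

-- Shortcuts: the search for these instances is slow.
noncomputable instance : Group UnitQuaternion := Metric.unitSphere.instGroup

instance : IsTopologicalGroup UnitQuaternion := Metric.sphere.instIsTopologicalGroup

lemma UnitQuaternion.sum_sq (q : UnitQuaternion) :
    q.1.re ^ 2 + q.1.imI ^ 2 + q.1.imJ ^ 2 + q.1.imK ^ 2 = 1 := by
  rw [← Quaternion.normSq_def', Quaternion.normSq_eq_norm_mul_self,
    mem_sphere_zero_iff_norm.1 q.2, one_mul]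

lemma rotationMatrix_mul (p q : Quaternion ℝ) :
    rotationMatrix (p * q) = rotationMatrix p * rotationMatrix q := by
  ext i j
  fin_cases i <;> fin_cases j <;>
    simp [rotationMatrix, Matrix.mul_apply, Fin.sum_univ_three] <;> ring

lemma rotationMatrix_mem (q : UnitQuaternion) :
    rotationMatrix q.1 ∈ Matrix.orthogonalGroup (Fin 3) ℝ := by
  rw [Matrix.mem_orthogonalGroup_iff]
  have h := q.sum_sq
  have h2 : (q.1.re ^ 2 + q.1.imI ^ 2 + q.1.imJ ^ 2 + q.1.imK ^ 2) ^ 2 = 1 := by rw [h, one_pow]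
  ext i j
  fin_cases i <;> fin_cases j <;>
    simp [rotationMatrix, Matrix.mul_apply, Fin.sum_univ_three] <;>
    first
      | linear_combination h2
      | ring

lemma rotationMatrix_one : rotationMatrix 1 = 1 := by
  ext i j
  fin_cases i <;> fin_cases j <;> simp [rotationMatrix]

/-- The homomorphism `S³ → O(3)` sending a unit quaternion to its rotation. -/
noncomputable def rotationHom : UnitQuaternion →* Matrix.orthogonalGroup (Fin 3) ℝ where
  toFun q := ⟨rotationMatrix q.1, rotationMatrix_mem q⟩
  map_one' := Subtype.ext rotationMatrix_one
  map_mul' p q := Subtype.ext (rotationMatrix_mul p.1 q.1)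

lemma continuous_rotationHom : Continuous rotationHom := by
  refine Continuous.subtype_mk ?_ _
  have h0 : Continuous fun q : UnitQuaternion => q.1.re :=
    Quaternion.continuous_re.comp continuous_subtype_val
  have h1 : Continuous fun q : UnitQuaternion => q.1.imI :=
    Quaternion.continuous_imI.comp continuous_subtype_val
  have h2 : Continuous fun q : UnitQuaternion => q.1.imJ :=
    Quaternion.continuous_imJ.comp continuous_subtype_val
  have h3 : Continuous fun q : UnitQuaternion => q.1.imK :=
    Quaternion.continuous_imK.comp continuous_subtype_val
  refine continuous_matrix fun i j => ?_
  fin_cases i <;> fin_cases j <;> simp [rotationMatrix] <;> fun_prop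

lemma eq_one_or_neg_one_of_rotationHom_eq_one {q : UnitQuaternion} (hq : rotationHom q = 1) :
    q = 1 ∨ q = -1 := by
  have hm : rotationMatrix q.1 = 1 := congrArg Subtype.val hq
  have hs := q.sum_sq
  have h0 : q.1.re ^ 2 + q.1.imI ^ 2 - q.1.imJ ^ 2 - q.1.imK ^ 2 = 1 := by
    simpa [rotationMatrix] using congrFun (congrFun hm 0) 0
  have h1 : q.1.re ^ 2 - q.1.imI ^ 2 + q.1.imJ ^ 2 - q.1.imK ^ 2 = 1 := by
    simpa [rotationMatrix] using congrFun (congrFun hm 1) 1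
  have hI : q.1.imI = 0 := by nlinarith [sq_nonneg q.1.imK, sq_nonneg q.1.imI]
  have hJ : q.1.imJ = 0 := by nlinarith [sq_nonneg q.1.imK, sq_nonneg q.1.imJ]
  have hK : q.1.imK = 0 := by nlinarith [sq_nonneg q.1.imK, sq_nonneg q.1.imJ]
  have hr : q.1.re = 1 ∨ q.1.re = -1 := by
    rw [hI, hJ, hK] at hs
    exact sq_eq_one_iff.1 (by linarith)
  refine hr.imp (fun h => ?_) fun h => ?_
  · refine Subtype.ext (?_ : q.1 = (1 : Quaternion ℝ))
    ext <;> simp [h, hI, hJ, hK]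
  · refine Subtype.ext (?_ : q.1 = -(1 : Quaternion ℝ))
    ext <;> simp [h, hI, hJ, hK]

lemma finite_hyperoctahedralGroup (n : ℕ) :
    (hyperoctahedralGroup n : Set (Matrix.orthogonalGroup (Fin n) ℝ)).Finite := by
  refine Set.Finite.of_finite_image (f := Subtype.val) ((Set.finite_range
    (fun p : Equiv.Perm (Fin n) × (Fin n → ℤˣ) =>
      (Matrix.of fun i j => if i = p.1 j then ((p.2 j : ℤ) : ℝ) else 0 :
        Matrix (Fin n) (Fin n) ℝ))).subset ?_) Subtype.val_injective.injOn
  rintro _ ⟨A, ⟨σ, ε, h⟩, rfl⟩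
  exact ⟨(σ, ε), by ext i j; exact (h i j).symm⟩

instance isClosed_hyperoctahedralGroup (n : ℕ) :
    IsClosed (hyperoctahedralGroup n : Set (Matrix.orthogonalGroup (Fin n) ℝ)) :=
  (finite_hyperoctahedralGroup n).isClosed

lemma isDiscrete_comap_rotationHom :
    IsDiscrete ((hyperoctahedralGroup 3).comap rotationHom : Set UnitQuaternion) := by
  refine Set.Finite.isDiscrete ?_
  rw [Subgroup.coe_comap]
  refine (finite_hyperoctahedralGroup 3).preimage' fun A _ => ?_
  by_cases hA : ∃ p, rotationHom p = A
  · obtain ⟨p, rfl⟩ := hA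
    refine (Set.toFinite {p, -p}).subset fun q hq => ?_
    have h : rotationHom (p⁻¹ * q) = 1 := by
      rw [map_mul, map_inv, show rotationHom q = rotationHom p from hq, inv_mul_cancel]
    rcases eq_one_or_neg_one_of_rotationHom_eq_one h with h | h
    · exact Or.inl (inv_mul_eq_one.1 h).symm
    · right
      rw [inv_mul_eq_iff_eq_mul] at h
      simpa using h
  · convert Set.finite_empty
    ext q
    simpa using fun h => hA ⟨q, h⟩

/-- A rotation matrix of nonnegative trace `t` comes from the quaternion whose real part is
proportional to `1 + t` and whose imaginary part is the axis read off from `A - Aᵀ`. -/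
lemma exists_rotationMatrix_eq (A : Matrix (Fin 3) (Fin 3) ℝ)
    (hA : A ∈ Matrix.orthogonalGroup (Fin 3) ℝ) (hdet : A.det = 1) (htr : 0 ≤ A.trace) :
    ∃ q : UnitQuaternion, rotationMatrix q.1 = A := by
  have hA1 := (Matrix.mem_orthogonalGroup_iff (Fin 3) ℝ).1 hA
  have hA2 := (Matrix.mem_orthogonalGroup_iff' (Fin 3) ℝ).1 hA
  -- the inverse of an orthogonal matrix of determinant `1` is its adjugate
  have hadj : A.adjugate = A.transpose := by
    have h := Matrix.adjugate_mul A
    rw [hdet, one_smul] at h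
    calc A.adjugate = A.adjugate * (A * A.transpose) := by rw [hA1, mul_one]
      _ = A.transpose := by rw [← mul_assoc, h, one_mul]
  have hr (i j) := congrFun (congrFun hA1 i) j
  have hc (i j) := congrFun (congrFun hA2 i) j
  have hd (i j) := congrFun (congrFun hadj i) j
  simp only [Matrix.adjugate_fin_three, Matrix.transpose_apply] at hd
  simp only [Matrix.mul_apply, Matrix.transpose_apply, Fin.sum_univ_three] at hr hc
  simp only [Matrix.trace_fin_three] at htr
  have r00 := hr 0 0
  have r01 := hr 0 1
  have r02 := hr 0 2
  have r11 := hr 1 1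
  have r12 := hr 1 2
  have r22 := hr 2 2
  have c00 := hc 0 0
  have c01 := hc 0 1
  have c02 := hc 0 2
  have c11 := hc 1 1
  have c12 := hc 1 2
  have c22 := hc 2 2
  have d00 := hd 0 0
  have d01 := hd 0 1
  have d02 := hd 0 2
  have d10 := hd 1 0
  have d11 := hd 1 1
  have d12 := hd 1 2
  have d20 := hd 2 0
  have d21 := hd 2 1
  have d22 := hd 2 2
  simp at r00 r01 r02 r11 r12 r22 c00 c01 c02 c11 c12 c22 d00 d01 d02 d10 d11 d12 d20 d21 d22
  set N : ℝ := 4 * (1 + (A 0 0 + A 1 1 + A 2 2)) with hN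
  have hNpos : 0 < N := by linarith
  set q₀ : Quaternion ℝ := ⟨1 + (A 0 0 + A 1 1 + A 2 2), A 2 1 - A 1 2, A 0 2 - A 2 0,
    A 1 0 - A 0 1⟩ with hq₀
  have hnorm : ‖q₀‖ ^ 2 = N := by
    rw [sq, ← Quaternion.normSq_eq_norm_mul_self, Quaternion.normSq_def', hN]
    simp only [q₀]
    linear_combination r00 + r11 + r22 + 2 * d00 + 2 * d11 + 2 * d22
  have hn : ‖q₀‖ ≠ 0 := fun h => by rw [h] at hnorm; norm_num at hnorm; linarith
  refine ⟨⟨‖q₀‖⁻¹ • q₀, by simp [norm_smul, hn]⟩, ?_⟩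
  have hsq : ‖q₀‖⁻¹ ^ 2 * N = 1 := by
    rw [← hnorm]; field_simp
  have hM : rotationMatrix q₀ = N • A := by
    ext i j
    fin_cases i <;> fin_cases j <;> simp [rotationMatrix, q₀, hN]
    · linear_combination r11 + r22 - r00 - 2 * c00 + 2 * d00 - 2 * d11 - 2 * d22
    · linear_combination 2 * d01 + 2 * d10 - 2 * r01 - 2 * c01
    · linear_combination 2 * d02 + 2 * d20 - 2 * r02 - 2 * c02
    · linear_combination 2 * d01 + 2 * d10 - 2 * r01 - 2 * c01
    · linear_combination r00 + r22 - r11 - 2 * c11 + 2 * d11 - 2 * d00 - 2 * d22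
    · linear_combination 2 * d12 + 2 * d21 - 2 * r12 - 2 * c12
    · linear_combination 2 * d02 + 2 * d20 - 2 * r02 - 2 * c02
    · linear_combination 2 * d12 + 2 * d21 - 2 * r12 - 2 * c12
    · linear_combination r00 + r11 - r22 - 2 * c22 + 2 * d22 - 2 * d00 - 2 * d11
  have hsmul : rotationMatrix (‖q₀‖⁻¹ • q₀) = ‖q₀‖⁻¹ ^ 2 • rotationMatrix q₀ := by
    ext i j
    fin_cases i <;> fin_cases j <;> simp [rotationMatrix] <;> ring
  rw [hsmul, hM, smul_smul, hsq, one_smul]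

/-- Changing signs of columns makes a real `3 × 3` matrix of determinant `±1` into one of
determinant `1` and nonnegative trace: the traces for the four sign changes with a given
determinant add up to zero. -/
lemma exists_signs_det_eq_one_trace_nonneg (A : Matrix (Fin 3) (Fin 3) ℝ)
    (hA : A.det = 1 ∨ A.det = -1) : ∃ ε : Fin 3 → ℤˣ,
      (A * Matrix.diagonal fun i => ((ε i : ℤ) : ℝ)).det = 1 ∧
      0 ≤ (A * Matrix.diagonal fun i => ((ε i : ℤ) : ℝ)).trace := by
  simp only [Matrix.det_mul, Matrix.det_diagonal, Matrix.trace_fin_three, Matrix.mul_diagonal,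
    Fin.prod_univ_three]
  obtain ⟨s, hs⟩ : ∃ s : ℤˣ, A.det * ((s : ℤ) : ℝ) = 1 := by
    rcases hA with h | h
    · exact ⟨1, by simp [h]⟩
    · exact ⟨-1, by simp [h]⟩
  have hss : ((s : ℤ) : ℝ) * ((s : ℤ) : ℝ) = 1 := by
    rcases Int.units_eq_one_or s with rfl | rfl <;> simp
  set c : ℝ := ((s : ℤ) : ℝ)
  by_contra! h
  have h0 := h ![s, s, s] (by simp; linear_combination hs + A.det * c * hss)
  have h1 := h ![s, -s, -s] (by simp; linear_combination hs + A.det * c * hss)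
  have h2 := h ![-s, s, -s] (by simp; linear_combination hs + A.det * c * hss)
  have h3 := h ![-s, -s, s] (by simp; linear_combination hs + A.det * c * hss)
  simp at h0 h1 h2 h3
  linarith

/-- The map `S³ → O(3) / B₃` sending a unit quaternion to the rotated coordinate frame. -/
noncomputable def frameOfQuaternion (q : UnitQuaternion) : FrameSpace 3 :=
  QuotientGroup.mk (rotationHom q)

lemma continuous_frameOfQuaternion : Continuous frameOfQuaternion :=
  QuotientGroup.continuous_mk.comp continuous_rotationHom

lemma surjective_frameOfQuaternion : Function.Surjective frameOfQuaternion := by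
  intro x
  obtain ⟨A, rfl⟩ := QuotientGroup.mk_surjective x
  have hdet : A.1.det = 1 ∨ A.1.det = -1 := by
    have h := congrArg Matrix.det ((Matrix.mem_orthogonalGroup_iff (Fin 3) ℝ).1 A.2)
    rw [Matrix.det_mul, Matrix.det_one, Matrix.det_transpose] at h
    exact mul_self_eq_one_iff.1 h
  obtain ⟨ε, h1, h2⟩ := exists_signs_det_eq_one_trace_nonneg A.1 hdet
  have hD : (Matrix.diagonal fun i => ((ε i : ℤ) : ℝ)) ∈ Matrix.orthogonalGroup (Fin 3) ℝ := by
    rw [Matrix.mem_orthogonalGroup_iff, Matrix.diagonal_transpose, Matrix.diagonal_mul_diagonal,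
      ← Matrix.diagonal_one]
    congr 1
    ext i
    rcases Int.units_eq_one_or (ε i) with h | h <;> simp [h]
  let D : Matrix.orthogonalGroup (Fin 3) ℝ := ⟨_, hD⟩
  obtain ⟨q, hq⟩ := exists_rotationMatrix_eq (A * D).1 (A * D).2 h1 h2
  refine ⟨q, (QuotientGroup.eq.2 ?_ : QuotientGroup.mk A = _).symm⟩
  have : A⁻¹ * rotationHom q = D := by
    rw [inv_mul_eq_iff_eq_mul]
    exact Subtype.ext hq
  rw [this]
  exact ⟨1, ε, fun i j => by
    by_cases h : i = j
    · subst h; simp [D]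
    · simp [D, h]⟩

/-- The space of undirected frames is the quotient of `S³` by a finite subgroup, so `S³` is a
covering space of it. -/
lemma isCoveringMap_frameOfQuaternion : IsCoveringMap frameOfQuaternion :=
  ((IsQuotientMap.of_surjective_continuous surjective_frameOfQuaternion
    continuous_frameOfQuaternion).isQuotientCoveringMap_of_subgroupOp _
    isDiscrete_comap_rotationHom (fun {p q} => by
      simp only [frameOfQuaternion, QuotientGroup.eq, Subgroup.mem_comap, map_mul,
        map_inv])).isCoveringMap

end Covering

/-! ### Extension of frame fields from a sphere to a ball -/

section Extension

/-- Ordinary space with the Euclidean norm. -/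
local notation "E³" => EuclideanSpace ℝ (Fin 3)

lemma exists_sphericalCoordinates {x : E³} (hx : ‖x‖ = 1) :
    ∃ θ φ : ℝ, x = !₂[Real.cos θ * Real.cos φ, Real.sin θ * Real.cos φ, Real.sin φ] := by
  have hs : x 0 ^ 2 + x 1 ^ 2 + x 2 ^ 2 = 1 := by
    have h := EuclideanSpace.norm_sq_eq x
    simpa [hx, Fin.sum_univ_three] using h.symm
  set z : ℂ := ⟨x 0, x 1⟩ with hz
  have hzn : ‖z‖ = Real.cos (Real.arcsin (x 2)) := by
    rw [Real.cos_arcsin, Complex.norm_def, Complex.normSq_apply]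
    congr 1
    simp only [hz]
    linarith
  refine ⟨z.arg, Real.arcsin (x 2), ?_⟩
  rw [← hzn, mul_comm _ ‖z‖, mul_comm _ ‖z‖, Complex.norm_mul_cos_arg, Complex.norm_mul_sin_arg,
    Real.sin_arcsin (by nlinarith) (by nlinarith)]
  ext i
  fin_cases i <;> simp [hz]

/-- The cone over the image of the unit sphere of `ℝ³` under a `C¹` map to a space of dimension
at least `4` is not the whole space: it is the image of `ℝ³` under a `C¹` map, obtained from
spherical coordinates. -/
lemma exists_notMem_cone_image_sphere {F : Type*} [NormedAddCommGroup F] [NormedSpace ℝ F]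
    [FiniteDimensional ℝ F] (hF : 3 < Module.finrank ℝ F) {P : E³ → F} (hP : ContDiff ℝ 1 P) :
    ∃ v : F, ∀ (x : E³), ‖x‖ = 1 → ∀ r : ℝ, r • P x ≠ v := by
  let T : E³ → E³ := fun y => !₂[Real.cos (y 1) * Real.cos (y 2), Real.sin (y 1) * Real.cos (y 2),
    Real.sin (y 2)]
  have hT : ContDiff ℝ 1 T := by
    rw [contDiff_euclidean]
    intro i
    fin_cases i <;> simp only [T] <;> simp <;> fun_prop
  have hQ : ContDiff ℝ 1 fun y : E³ => y 0 • P (T y) := by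
    have h0 : ContDiff ℝ 1 fun y : E³ => y 0 := by fun_prop
    exact h0.smul (hP.comp hT)
  obtain ⟨v, hv⟩ := (hQ.dense_compl_range_of_finrank_lt_finrank (by simpa using hF)).nonempty
  refine ⟨v, fun x hx r h => hv ?_⟩
  obtain ⟨θ, φ, rfl⟩ := exists_sphericalCoordinates hx
  exact ⟨!₂[r, θ, φ], by simpa [T] using h⟩

/-- A map from the unit sphere of `ℝ³` to the unit sphere of a space of dimension at least `4`
extends to the unit ball without zeros. The map is deformed into a smooth one on the shell
`2/3 ≤ ‖y‖ ≤ 1`, which is deformed on the shell `1/3 ≤ ‖y‖ ≤ 2/3` to a constant, the opposite of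
a direction that the smooth map misses. -/
lemma exists_ne_zero_extension_closedBall {F : Type*} [NormedAddCommGroup F] [NormedSpace ℝ F]
    [FiniteDimensional ℝ F] (hF : 3 < Module.finrank ℝ F) {G : E³ → F} (hG : Continuous G)
    (hG1 : ∀ x, ‖x‖ = 1 → ‖G x‖ = 1) :
    ∃ Φ : E³ → F, Continuous Φ ∧ (∀ y, ‖y‖ ≤ 1 → Φ y ≠ 0) ∧ ∀ y, ‖y‖ = 1 → Φ y = G y := by
  obtain ⟨P, hP, hPG, -⟩ := hG.exists_contDiff_approx 1 (continuous_const (y := (1 : ℝ)))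
    (fun _ => one_pos)
  obtain ⟨v, hv⟩ := exists_notMem_cone_image_sphere hF hP
  have hPc : Continuous P := hP.continuous
  have hv0 : v ≠ 0 := fun h =>
    hv (EuclideanSpace.single 0 1) (by simp) 0 (by rw [zero_smul, h])
  -- the radial projection to the sphere outside of the ball of radius `1 / 3`
  let N : E³ → E³ := fun y => (max ‖y‖ (1 / 3))⁻¹ • y
  have hN : Continuous N :=
    ((continuous_norm.max continuous_const).inv₀ fun y =>
      (lt_max_of_lt_right (by norm_num)).ne').smul continuous_id
  have hN1 : ∀ y, 1 / 3 ≤ ‖y‖ → ‖N y‖ = 1 := fun y hy => by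
    have : 0 < ‖y‖ := by linarith
    simp only [N, max_eq_left hy, norm_smul, norm_inv, norm_norm]
    exact inv_mul_cancel₀ this.ne'
  -- `P` is closer to `G` than the distance of `G` to `0`
  have hGP : ∀ x, ‖x‖ = 1 → ∀ a b : ℝ, 0 ≤ a → 0 ≤ b → a + b = 1 → a • G x + b • P x ≠ 0 := by
    intro x hx a b ha hb hab h
    have h1 : G x = -(b • (P x - G x)) := by
      obtain rfl : a = 1 - b := by linarith
      rw [← sub_eq_zero, ← h]
      module
    have h2 : ‖G x‖ = b * dist (P x) (G x) := by
      rw [dist_eq_norm, ← Real.norm_of_nonneg hb, ← norm_smul, ← norm_neg (b • (P x - G x)), ← h1]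
    have h3 := hPG x
    rw [hG1 x hx] at h2
    nlinarith [dist_nonneg (x := P x) (y := G x)]
  refine ⟨fun y => max (3 * ‖y‖ - 2) 0 • G (N y) +
    max (min (3 * ‖y‖ - 1) (3 - 3 * ‖y‖)) 0 • P (N y) - max (2 - 3 * ‖y‖) 0 • v, by fun_prop,
    fun y hy => ?_, fun y hy => ?_⟩
  · beta_reduce
    rcases le_total ‖y‖ (1 / 3) with h1 | h1
    · rw [max_eq_right (by linarith), max_eq_right (min_le_of_left_le (by linarith)),
        max_eq_left (by linarith)]
      simp only [zero_smul, zero_add, zero_sub, neg_ne_zero]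
      exact smul_ne_zero (by linarith) hv0
    rcases le_total ‖y‖ (2 / 3) with h2 | h2
    · rw [max_eq_right (by linarith), min_eq_left (by linarith), max_eq_left (by linarith),
        max_eq_left (by linarith)]
      simp only [zero_smul, zero_add]
      rcases eq_or_lt_of_le h2 with h3 | h3
      · rw [h3]
        simpa [show (3 : ℝ) * (2 / 3) - 1 = 1 by norm_num,
          show (2 : ℝ) - 3 * (2 / 3) = 0 by norm_num] using
          hGP (N y) (hN1 y h1) 0 1 le_rfl zero_le_one (by norm_num)
      · intro h
        refine hv (N y) (hN1 y h1) ((2 - 3 * ‖y‖)⁻¹ * (3 * ‖y‖ - 1)) ?_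
        rw [mul_smul, sub_eq_zero.1 h, smul_smul, inv_mul_cancel₀ (by linarith), one_smul]
    · rw [max_eq_left (by linarith), min_eq_right (by linarith), max_eq_left (by linarith),
        max_eq_right (a := 2 - 3 * ‖y‖) (by linarith)]
      simpa using hGP (N y) (hN1 y h1) (3 * ‖y‖ - 2) (3 - 3 * ‖y‖) (by linarith) (by linarith)
        (by ring)
  · have : N y = y := by simp [N, hy]; norm_num
    simp [this, hy]
    norm_num

/-- The map from the plane to the unit sphere of `ℝ³` that is a homeomorphism from the open unit
disc to the complement of the south pole and sends everything else to the south pole. -/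
noncomputable def planeToSphere (z : ℂ) : Metric.sphere (0 : E³) 1 :=
  ⟨!₂[2 * z.re * √(max (1 - ‖z‖ ^ 2) 0), 2 * z.im * √(max (1 - ‖z‖ ^ 2) 0),
    max (1 - 2 * ‖z‖ ^ 2) (-1)], by
    have hz : z.re ^ 2 + z.im ^ 2 = ‖z‖ ^ 2 := by
      rw [Complex.sq_norm, Complex.normSq_apply]; ring
    rw [mem_sphere_zero_iff_norm, ← sq_eq_sq₀ (norm_nonneg _) zero_le_one,
      EuclideanSpace.norm_sq_eq, Fin.sum_univ_three]
    simp only [Real.norm_eq_abs, sq_abs]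
    simp only [Matrix.cons_val_zero, Matrix.cons_val_one, Matrix.cons_val]
    simp only [mul_pow, Real.sq_sqrt (le_max_right (1 - ‖z‖ ^ 2) 0)]
    rcases le_total (‖z‖ ^ 2) 1 with h | h
    · rw [max_eq_left (by linarith), max_eq_left (by linarith)]
      linear_combination 4 * (1 - ‖z‖ ^ 2) * hz
    · rw [max_eq_right (by linarith), max_eq_right (by linarith)]
      ring⟩

lemma continuous_planeToSphere : Continuous planeToSphere := by
  refine Continuous.subtype_mk ?_ _
  refine (PiLp.continuous_toLp 2 _).comp (continuous_pi fun i => ?_)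
  fin_cases i <;> simp <;> fun_prop

lemma surjOn_planeToSphere : SurjOn planeToSphere (Metric.closedBall 0 1) univ := by
  rintro ⟨x, hx⟩ -
  rw [mem_sphere_zero_iff_norm] at hx
  have hs : x 0 ^ 2 + x 1 ^ 2 + x 2 ^ 2 = 1 := by
    have h := EuclideanSpace.norm_sq_eq x
    simpa [hx, Fin.sum_univ_three] using h.symm
  have hlow : -1 ≤ x 2 := by nlinarith
  have hhigh : x 2 ≤ 1 := by nlinarith
  rcases eq_or_lt_of_le hlow with h | h
  · refine ⟨1, by simp, Subtype.ext ?_⟩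
    have h0 : x 0 = 0 := by rw [← h] at hs; nlinarith [sq_nonneg (x 0), sq_nonneg (x 1)]
    have h1 : x 1 = 0 := by rw [← h] at hs; nlinarith [sq_nonneg (x 0), sq_nonneg (x 1)]
    ext i
    fin_cases i
    · simp [planeToSphere, h0]
    · simp [planeToSphere, h1]
    · simp [planeToSphere, ← h]; norm_num
  · set s : ℝ := √((1 + x 2) / 2) with hsdef
    have hspos : 0 < s := Real.sqrt_pos.2 (by linarith)
    have hssq : s ^ 2 = (1 + x 2) / 2 := Real.sq_sqrt (by linarith)
    set z : ℂ := ⟨x 0 / (2 * s), x 1 / (2 * s)⟩ with hz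
    have hzn : ‖z‖ ^ 2 = (1 - x 2) / 2 := by
      rw [Complex.sq_norm, Complex.normSq_apply]
      simp only [hz]
      have : x 0 / (2 * s) * (x 0 / (2 * s)) + x 1 / (2 * s) * (x 1 / (2 * s))
          = (x 0 ^ 2 + x 1 ^ 2) / (4 * s ^ 2) := by field_simp; ring
      rw [this, hssq, div_eq_div_iff (by linarith) (by norm_num)]
      linear_combination 2 * hs
    have hw : √(max (1 - ‖z‖ ^ 2) 0) = s := by
      rw [hzn, max_eq_left (by linarith), hsdef]
      congr 1
      ring
    refine ⟨z, ?_, Subtype.ext ?_⟩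
    · rw [mem_closedBall_zero_iff, ← sq_le_one_iff₀ (norm_nonneg z), hzn]
      linarith
    · ext i
      fin_cases i
      · simp [planeToSphere, hw]; simp [hz]; field_simp
      · simp [planeToSphere, hw]; simp [hz]; field_simp
      · simp [planeToSphere, hzn]; rw [max_eq_left (by linarith)]; ring

lemma eq_or_norm_eq_one_of_planeToSphere_eq {z w : ℂ} (hz : ‖z‖ ≤ 1) (hw : ‖w‖ ≤ 1)
    (h : planeToSphere z = planeToSphere w) : z = w ∨ (‖z‖ = 1 ∧ ‖w‖ = 1) := by
  have hz2 : ‖z‖ ^ 2 ≤ 1 := pow_le_one₀ (norm_nonneg _) hz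
  have hw2 : ‖w‖ ^ 2 ≤ 1 := pow_le_one₀ (norm_nonneg _) hw
  have h' (i) : (planeToSphere z).1 i = (planeToSphere w).1 i := by rw [h]
  have h0 := h' 0
  have h1 := h' 1
  have h2 := h' 2
  simp only [planeToSphere, PiLp.toLp_apply, Matrix.cons_val_zero, Matrix.cons_val_one,
    Matrix.cons_val] at h0 h1 h2
  rw [max_eq_left (by linarith), max_eq_left (by linarith)] at h0 h1 h2
  have hn : ‖z‖ ^ 2 = ‖w‖ ^ 2 := by linarith
  rw [hn] at h0 h1
  rcases eq_or_lt_of_le hw2 with h3 | h3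
  · right
    rw [h3] at hn
    exact ⟨(pow_eq_one_iff_of_nonneg (norm_nonneg _) two_ne_zero).1 hn,
      (pow_eq_one_iff_of_nonneg (norm_nonneg _) two_ne_zero).1 h3⟩
  · left
    have hs : √(1 - ‖w‖ ^ 2) ≠ 0 := (Real.sqrt_pos.2 (by linarith)).ne'
    have h0 := mul_right_cancel₀ hs h0
    have h1 := mul_right_cancel₀ hs h1
    exact Complex.ext (by linarith) (by linarith)

/-- Maps from the unit sphere of `ℝ³` lift through surjective covering maps. The composition with
`planeToSphere` lifts because the plane is simply connected. Since the unit circle is connected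
and collapsed to a point, the lift is constant on it and thus descends to the sphere. -/
lemma IsCoveringMap.exists_lift_sphere {E X : Type*} [TopologicalSpace E] [TopologicalSpace X]
    {p : E → X} (hp : IsCoveringMap p) (hsurj : Function.Surjective p)
    (f : C(Metric.sphere (0 : E³) 1, X)) :
    ∃ g : C(Metric.sphere (0 : E³) 1, E), ∀ x, p (g x) = f x := by
  obtain ⟨e, he⟩ := hsurj (f (planeToSphere 0))
  obtain ⟨h, ⟨-, hh⟩, -⟩ := hp.existsUnique_continuousMap_lifts
    (f.comp ⟨planeToSphere, continuous_planeToSphere⟩) 0 e he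
  have hh' (z : ℂ) : p (h z) = f (planeToSphere z) := congrFun hh z
  let q : C(Metric.closedBall (0 : ℂ) 1, Metric.sphere (0 : E³) 1) :=
    ⟨fun z => planeToSphere z, continuous_planeToSphere.comp continuous_subtype_val⟩
  have hq : Function.Surjective q := fun x => by
    obtain ⟨z, hz, rfl⟩ := surjOn_planeToSphere (mem_univ x)
    exact ⟨⟨z, hz⟩, rfl⟩
  have hquot : IsQuotientMap q := IsQuotientMap.of_surjective_continuous hq q.continuous
  have hpole : ∀ z ∈ Metric.sphere (0 : ℂ) 1, planeToSphere z = planeToSphere 1 := fun z hz => by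
    rw [mem_sphere_zero_iff_norm] at hz
    refine Subtype.ext ?_
    ext i
    fin_cases i <;> simp [planeToSphere, hz]
  have hconst : ∀ z ∈ Metric.sphere (0 : ℂ) 1, ∀ w ∈ Metric.sphere (0 : ℂ) 1, h z = h w :=
    fun z hz w hw => hp.constOn_of_comp
      (isPreconnected_sphere (by simp [Complex.rank_real_complex]) (0 : ℂ) 1)
      h.continuous.continuousOn
      (fun a ha b hb => by rw [hh', hh', hpole a ha, hpole b hb]) hz hw
  have hfac (a b) (hab : q a = q b) : h a.1 = h b.1 := by
    rcases eq_or_norm_eq_one_of_planeToSphere_eq (mem_closedBall_zero_iff.1 a.2)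
      (mem_closedBall_zero_iff.1 b.2) hab with h1 | ⟨h1, h2⟩
    · exact congrArg h h1
    · exact hconst _ (mem_sphere_zero_iff_norm.2 h1) _ (mem_sphere_zero_iff_norm.2 h2)
  refine ⟨hquot.lift (h.comp ⟨Subtype.val, continuous_subtype_val⟩) hfac, fun x => ?_⟩
  obtain ⟨z, rfl⟩ := hq x
  have hz := congrArg (fun k => k z) (hquot.lift_comp
    (h.comp ⟨Subtype.val, continuous_subtype_val⟩) hfac)
  simp only [ContinuousMap.comp_apply] at hz
  rw [hz]
  exact hh' z

/-- Undirected frame fields extend from spheres to balls: the second homotopy group of the space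
of frames vanishes. -/
lemma exists_frame_extension_closedBall {f : E³ → FrameSpace 3} {c : E³} {r : ℝ} (hr : 0 < r)
    (hf : ContinuousOn f (Metric.sphere c r)) :
    ∃ Φ : E³ → FrameSpace 3, ContinuousOn Φ (Metric.closedBall c r) ∧
      EqOn Φ f (Metric.sphere c r) := by
  have hmem (x : E³) (hx : ‖x‖ = 1) : c + r • x ∈ Metric.sphere c r := by
    simp [norm_smul, hx, hr.le]
  obtain ⟨g, hg⟩ := isCoveringMap_frameOfQuaternion.exists_lift_sphere
    surjective_frameOfQuaternion
    ⟨fun x => f (c + r • x.1), hf.comp_continuous (by fun_prop) fun x =>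
      hmem x.1 (mem_sphere_zero_iff_norm.1 x.2)⟩
  obtain ⟨G, hG⟩ := ContinuousMap.exists_restrict_eq (Y := Quaternion ℝ)
    (Metric.isClosed_sphere (x := (0 : E³)) (ε := 1))
    ⟨fun x => (g x).1, continuous_subtype_val.comp g.continuous⟩
  have hG' (x : Metric.sphere (0 : E³) 1) : G x = (g x).1 := congrArg (fun k => k x) hG
  obtain ⟨Φ, hΦ, hΦ0, hΦG⟩ := exists_ne_zero_extension_closedBall
    (by rw [Quaternion.finrank_eq_four]; norm_num) G.continuous fun x hx => by
      have := hG' ⟨x, mem_sphere_zero_iff_norm.2 hx⟩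
      rw [this]
      exact mem_sphere_zero_iff_norm.1 (g _).2
  let n : E³ → E³ := fun y => r⁻¹ • (y - c)
  have hn : Continuous n := by fun_prop
  have hn1 : ∀ y ∈ Metric.closedBall c r, ‖n y‖ ≤ 1 := fun y hy => by
    rw [norm_smul, Real.norm_of_nonneg (by positivity), inv_mul_le_iff₀ hr, mul_one,
      ← dist_eq_norm]
    exact hy
  have hfin : ContinuousOn (fun y => ‖Φ (n y)‖⁻¹ • Φ (n y)) (Metric.closedBall c r) :=
    ((hΦ.comp hn).norm.continuousOn.inv₀ fun y hy => norm_ne_zero_iff.2 (hΦ0 _ (hn1 y hy))).smul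
      (hΦ.comp hn).continuousOn
  have hunit : ∀ y ∈ Metric.closedBall c r,
      ‖Φ (n y)‖⁻¹ • Φ (n y) ∈ Metric.sphere (0 : Quaternion ℝ) 1 := fun y hy => by
    have := norm_ne_zero_iff.2 (hΦ0 _ (hn1 y hy))
    simp [norm_smul, this]
  classical
  refine ⟨fun y => if hy : y ∈ Metric.closedBall c r then
    frameOfQuaternion ⟨_, hunit y hy⟩ else f y, ?_, fun y hy => ?_⟩
  · rw [continuousOn_iff_continuous_domRestrict] at hfin ⊢
    refine (continuous_frameOfQuaternion.comp (hfin.subtype_mk fun y => hunit y y.2)).congr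
      fun y => ?_
    simp only [Function.comp_apply, domRestrict_apply]
    rw [dif_pos y.2]
  · have hny : ‖n y‖ = 1 := by
      rw [norm_smul, Real.norm_of_nonneg (by positivity), ← dist_eq_norm, Metric.mem_sphere.1 hy,
        inv_mul_cancel₀ hr.ne']
    have hgy : Φ (n y) = (g ⟨n y, mem_sphere_zero_iff_norm.2 hny⟩).1 := by
      rw [hΦG _ hny]
      exact hG' ⟨n y, _⟩
    have hy' : y ∈ Metric.closedBall c r := Metric.sphere_subset_closedBall hy
    have hyn : c + r • n y = y := by
      simp only [n, smul_smul, mul_inv_cancel₀ hr.ne', one_smul]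
      abel
    have h1 := hg ⟨n y, mem_sphere_zero_iff_norm.2 hny⟩
    simp only [ContinuousMap.coe_mk, hyn] at h1
    simp only [hy', dif_pos]
    rw [← h1]
    congr 1
    refine Subtype.ext ?_
    simp only [hgy, mem_sphere_zero_iff_norm.1 (g _).2, inv_one, one_smul]

end Extension

/-! ### Pushing an arc off along itself -/

/-- The part of the arc `γ` between the parameters `s` and `t` can be pushed off: arbitrarily close
to it there is a self-map of the ambient space that maps only points of `γ [t, 1]` to `γ [s, 1]`. -/
def CanPushOff {E : Type*} [TopologicalSpace E] (γ : ℝ → E) (s t : ℝ) : Prop :=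
  ∀ V : Set E, IsOpen V → γ '' Icc s t ⊆ V → ∃ σ : E → E, Continuous σ ∧ (∀ x ∉ V, σ x = x) ∧
    MapsTo σ V V ∧ ∀ x, σ x ∈ γ '' Icc s 1 → x ∈ γ '' Icc t 1

lemma CanPushOff.refl {E : Type*} [TopologicalSpace E] (γ : ℝ → E) (s : ℝ) : CanPushOff γ s s :=
  fun _ _ _ => ⟨id, continuous_id, fun _ _ => rfl, fun _ h => h, fun _ h => h⟩

lemma CanPushOff.trans {E : Type*} [TopologicalSpace E] {γ : ℝ → E} {r s t : ℝ}
    (hrs : r ≤ s) (hst : s ≤ t)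
    (h₁ : CanPushOff γ r s) (h₂ : CanPushOff γ s t) : CanPushOff γ r t := by
  intro V hV hγ
  obtain ⟨σ, hσ, hσV, hσm, hσγ⟩ :=
    h₁ V hV ((image_mono (Icc_subset_Icc_right hst)).trans hγ)
  obtain ⟨τ, hτ, hτV, hτm, hτγ⟩ :=
    h₂ V hV ((image_mono (Icc_subset_Icc_left hrs)).trans hγ)
  exact ⟨σ ∘ τ, hσ.comp hτ, fun x hx => by simp [hτV x hx, hσV x hx], hσm.comp hτm,
    fun x hx => hτγ x (hσγ _ hx)⟩

section Arc

variable {E : Type*} [NormedAddCommGroup E] [NormedSpace ℝ E]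

/-- A tame arc in a normed space, parametrized by `[0, 1]`: an embedded arc near every point of
which some linear functional is strictly increasing along the arc, so that the arc is locally a
graph over a line. The values of `γ` outside `[0, 1]` carry no meaning. -/
structure IsTameArc (γ : ℝ → E) : Prop where
  continuousOn : ContinuousOn γ (Icc 0 1)
  injOn : InjOn γ (Icc 0 1)
  exists_strictMonoOn : ∀ t ∈ Icc (0 : ℝ) 1, ∃ ℓ : E →L[ℝ] ℝ, ∃ δ > 0,
    StrictMonoOn (fun τ => ℓ (γ τ)) (Icc 0 1 ∩ Icc (t - δ) (t + δ))

lemma IsTameArc.reverse {γ : ℝ → E} (hγ : IsTameArc γ) : IsTameArc fun t => γ (1 - t) where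
  continuousOn := hγ.continuousOn.comp (by fun_prop) fun t ht => ⟨by linarith [ht.2],
    by linarith [ht.1]⟩
  injOn s hs t ht h := by
    have := hγ.injOn (x₁ := 1 - s) (x₂ := 1 - t) ⟨by linarith [hs.2], by linarith [hs.1]⟩
      ⟨by linarith [ht.2], by linarith [ht.1]⟩ h
    linarith
  exists_strictMonoOn t ht := by
    obtain ⟨ℓ, δ, hδ, h⟩ := hγ.exists_strictMonoOn (1 - t) ⟨by linarith [ht.2], by linarith [ht.1]⟩
    refine ⟨-ℓ, δ, hδ, fun x hx y hy hxy => ?_⟩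
    simp only [neg_apply, neg_lt_neg_iff]
    exact h ⟨⟨by linarith [hy.1.2], by linarith [hy.1.1]⟩, by linarith [hy.2.2],
      by linarith [hy.2.1]⟩ ⟨⟨by linarith [hx.1.2], by linarith [hx.1.1]⟩, by linarith [hx.2.2],
      by linarith [hx.2.1]⟩ (by linarith)

lemma isTameArc_of_contDiffOn {γ : ℝ → E} (hγ : ContDiffOn ℝ 1 γ (Icc 0 1))
    (hinj : InjOn γ (Icc 0 1)) (hd : ∀ t ∈ Icc (0 : ℝ) 1, derivWithin γ (Icc 0 1) t ≠ 0) :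
    IsTameArc γ where
  continuousOn := hγ.continuousOn
  injOn := hinj
  exists_strictMonoOn t ht := by
    obtain ⟨ℓ, hℓ⟩ := SeparatingDual.exists_eq_one (R := ℝ) (hd t ht)
    have hcont : ContinuousOn (fun τ => ℓ (derivWithin γ (Icc 0 1) τ)) (Icc 0 1) :=
      ℓ.continuous.comp_continuousOn
        (hγ.continuousOn_derivWithin (uniqueDiffOn_Icc zero_lt_one) le_rfl)
    have hpos : ∀ᶠ τ in 𝓝[Icc 0 1] t, 0 < ℓ (derivWithin γ (Icc 0 1) τ) :=
      (hcont t ht).eventually (lt_mem_nhds (one_pos.trans_eq hℓ.symm))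
    obtain ⟨δ, hδ, hδpos⟩ := Metric.mem_nhdsWithin_iff.1 hpos
    refine ⟨ℓ, δ / 2, half_pos hδ, strictMonoOn_of_deriv_pos ((convex_Icc _ _).inter
      (convex_Icc _ _)) ((ℓ.continuous.comp_continuousOn hγ.continuousOn).mono inter_subset_left)
      fun τ hτ => ?_⟩
    have hτI : Icc (0 : ℝ) 1 ∈ 𝓝 τ :=
      mem_interior_iff_mem_nhds.1 (interior_mono inter_subset_left hτ)
    have hτ' := interior_subset hτ
    have hder : HasDerivAt γ (derivWithin γ (Icc 0 1) τ) τ :=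
      ((hγ.differentiableOn one_ne_zero τ hτ'.1).hasDerivWithinAt).hasDerivAt hτI
    have hderℓ : HasDerivAt (fun τ => ℓ (γ τ)) (ℓ (derivWithin γ (Icc 0 1) τ)) τ :=
      ℓ.hasFDerivAt.comp_hasDerivAt τ hder
    rw [hderℓ.deriv]
    refine hδpos ⟨?_, hτ'.1⟩
    rw [Metric.mem_ball, Real.dist_eq, abs_lt]
    constructor <;> linarith [hτ'.2.1, hτ'.2.2]

/-- The amount by which a point at height `p` is pushed down in order to move the segment
`[a, c)` below `a`: the points of `[a - κ, c]` are all sent to `a - κ`. -/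
noncomputable def pushAmount (a c κ p : ℝ) : ℝ :=
  max 0 (min (p - a + κ) ((c - a + κ) * (c + κ - p) / κ))

lemma continuous_pushAmount (a c κ : ℝ) : Continuous (pushAmount a c κ) := by
  unfold pushAmount
  fun_prop

lemma pushAmount_nonneg (a c κ p : ℝ) : 0 ≤ pushAmount a c κ p := le_max_left _ _

lemma pushAmount_eq_zero {a c κ p : ℝ} (hac : a ≤ c) (hκ : 0 < κ) (hp : p ∉ Icc (a - κ) (c + κ)) :
    pushAmount a c κ p = 0 := by
  rw [mem_Icc, not_and_or, not_le, not_le] at hp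
  refine max_eq_left ?_
  rcases hp with hp | hp
  · exact min_le_of_left_le (by linarith)
  · exact min_le_of_right_le
      (div_nonpos_of_nonpos_of_nonneg (mul_nonpos_of_nonneg_of_nonpos (by linarith) (by linarith))
        hκ.le)

lemma le_sub_pushAmount {a c κ p : ℝ} (hp : a - κ ≤ p) : a - κ ≤ p - pushAmount a c κ p := by
  have : pushAmount a c κ p ≤ p - a + κ := max_le (by linarith) (min_le_left _ _)
  linarith

lemma sub_pushAmount_lt {a c κ p : ℝ} (hκ : 0 < κ) (hac : a ≤ c) (hp : p < c) :
    p - pushAmount a c κ p < a := by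
  rcases lt_or_ge p a with h | h
  · linarith [pushAmount_nonneg a c κ p]
  · have h1 : p - a + κ ≤ (c - a + κ) * (c + κ - p) / κ := by
      rw [le_div_iff₀ hκ]
      nlinarith
    have h2 : p - a + κ ≤ pushAmount a c κ p := by
      unfold pushAmount
      rw [min_eq_left h1]
      exact le_max_right _ _
    linarith

/-- Near each of its points a tame arc can be pushed off along itself. In the coordinates
`x ↦ (ℓ x, x - H (ℓ x))`, where the arc is the graph of `H`, the push moves points down in the
first coordinate, inside a thin tube around the given piece of the arc. -/
lemma IsTameArc.exists_canPushOff_near [FiniteDimensional ℝ E] {γ : ℝ → E} (hγ : IsTameArc γ)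
    {t₀ : ℝ} (ht₀ : t₀ ∈ Icc (0 : ℝ) 1) : ∃ δ > 0, ∀ s t, s ∈ Ioo (t₀ - δ) (t₀ + δ) →
      t ∈ Ioo (t₀ - δ) (t₀ + δ) → 0 ≤ s → s ≤ t → t < 1 → CanPushOff γ s t := by
  obtain ⟨ℓ, δ, hδ, hmono⟩ := hγ.exists_strictMonoOn t₀ ht₀
  refine ⟨δ, hδ, fun s t hs ht hs0 hst ht1 V hV hVγ => ?_⟩
  set J : Set ℝ := Icc 0 1 ∩ Icc (t₀ - δ) (t₀ + δ) with hJ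
  have hJc : IsCompact J := isCompact_Icc.inter isCompact_Icc
  have hJI : J ⊆ Icc 0 1 := inter_subset_left
  have hsJ : s ∈ J := ⟨⟨hs0, by linarith⟩, hs.1.le, hs.2.le⟩
  have htJ : t ∈ J := ⟨⟨by linarith, ht1.le⟩, ht.1.le, ht.2.le⟩
  -- a parameter beyond `t` up to which the arc is a graph
  obtain ⟨t', htt', ht'J⟩ : ∃ t', t < t' ∧ t' ∈ J :=
    ⟨min 1 (t₀ + δ), lt_min ht1 ht.2, ⟨le_min zero_le_one (by linarith [ht₀.1]), min_le_left _ _⟩,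
      le_min (by linarith [ht₀.2]) (by linarith), min_le_right _ _⟩
  have hJconv : ∀ τ ∈ Icc s t', τ ∈ J := fun τ hτ =>
    ⟨⟨hs0.trans hτ.1, hτ.2.trans ht'J.1.2⟩, hs.1.le.trans hτ.1, hτ.2.trans ht'J.2.2⟩
  have hℓ : ℓ (γ t') - ℓ (γ t) ≠ 0 := (sub_pos.2 (hmono htJ ht'J htt')).ne'
  obtain ⟨u, hu⟩ : ∃ u, ℓ u = 1 :=
    ⟨(ℓ (γ t') - ℓ (γ t))⁻¹ • (γ t' - γ t), by simp [hℓ]⟩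
  have hγJ : ContinuousOn γ J := hγ.continuousOn.mono hJI
  have : CompactSpace J := isCompact_iff_compactSpace.1 hJc
  -- `H` is a section of `ℓ` over the whole line whose image contains the arc near `t₀`; it comes
  -- from the Tietze extension theorem
  have hemb : IsClosedEmbedding fun τ : J => ℓ (γ τ) :=
    Continuous.isClosedEmbedding
      (ℓ.continuous.comp (continuousOn_iff_continuous_domRestrict.1 hγJ))
      fun a b h => Subtype.ext (hmono.injOn a.2 b.2 h)
  have : TietzeExtension E := TietzeExtension.of_tvs ℝ
  obtain ⟨g, hg⟩ := ContinuousMap.exists_extension' hemb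
    ⟨fun τ : J => γ τ, continuousOn_iff_continuous_domRestrict.1 hγJ⟩
  set H : ℝ → E := fun p => g p + (p - ℓ (g p)) • u with hH
  have hHc : Continuous H := by fun_prop
  have hℓH : ∀ p, ℓ (H p) = p := fun p => by simp [hH, hu]
  have hHγ : ∀ τ ∈ J, H (ℓ (γ τ)) = γ τ := fun τ hτ => by
    have : g (ℓ (γ τ)) = γ τ := congrFun hg ⟨τ, hτ⟩
    simp [hH, this]
  set a := ℓ (γ s) with ha
  set c := ℓ (γ t) with hc
  have hac : a ≤ c := hmono.monotoneOn hsJ htJ hst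
  -- intermediate values of `ℓ ∘ γ` are attained
  have hivt : ∀ t₁ t₂, s ≤ t₁ → t₁ ≤ t₂ → t₂ ≤ t' → ∀ p ∈ Icc (ℓ (γ t₁)) (ℓ (γ t₂)),
      ∃ τ ∈ Icc t₁ t₂, ℓ (γ τ) = p := fun t₁ t₂ h1 h12 h2 p hp =>
    intermediate_value_Icc h12 ((ℓ.continuous.comp_continuousOn hγJ).mono fun τ hτ =>
      hJconv τ ⟨h1.trans hτ.1, hτ.2.trans h2⟩) hp
  -- the far part of the arc
  set R : Set E := γ '' (Icc 0 1 \ Ioo (t₀ - δ) (t₀ + δ)) with hR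
  have hRc : IsClosed R :=
    ((isCompact_Icc.diff isOpen_Ioo).image_of_continuousOn
      (hγ.continuousOn.mono sdiff_subset)).isClosed
  have hNR : IsOpen (V ∩ Rᶜ) := hV.inter hRc.isOpen_compl
  have hsub : (fun z : ℝ × E => H z.1 + z.2) '' (Icc a c ×ˢ {0}) ⊆ V ∩ Rᶜ := by
    rintro _ ⟨⟨p, y⟩, ⟨hp, rfl⟩, rfl⟩
    obtain ⟨τ, hτ, rfl⟩ := hivt s t le_rfl hst htt'.le p hp
    have hτJ : τ ∈ J := hJconv τ ⟨hτ.1, hτ.2.trans htt'.le⟩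
    simp only [hHγ τ hτJ, add_zero]
    refine ⟨hVγ (mem_image_of_mem γ hτ), ?_⟩
    rintro ⟨τ', hτ', h⟩
    obtain rfl := hγ.injOn hτ'.1 (hJI hτJ) h
    exact hτ'.2 ⟨hs.1.trans_le hτ.1, hτ.2.trans_lt ht.2⟩
  obtain ⟨κ₀, hκ₀, hκ₀V⟩ := (isCompact_Icc.prod isCompact_singleton).exists_cthickening_subset_open
    (hNR.preimage (show Continuous fun z : ℝ × E => H z.1 + z.2 by fun_prop))
    (image_subset_iff.1 hsub)
  set κ := min κ₀ (ℓ (γ t') - c) with hκ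
  have hκpos : 0 < κ := lt_min hκ₀ (sub_pos.2 (hmono htJ ht'J htt'))
  have hκκ₀ : κ ≤ κ₀ := min_le_left _ _
  have hκt' : c + κ ≤ ℓ (γ t') := by linarith [min_le_right κ₀ (ℓ (γ t') - c)]
  -- the tube in which points are moved
  let T : Set E := {x | ‖x - H (ℓ x)‖ ≤ κ ∧ ℓ x ∈ Icc (a - κ) (c + κ)}
  have hT : T ⊆ V ∩ Rᶜ := by
    rintro x ⟨hx1, hx2⟩
    have hmem : (ℓ x, x - H (ℓ x)) ∈ Metric.cthickening κ₀ (Icc a c ×ˢ ({0} : Set E)) := by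
      refine Metric.mem_cthickening_of_dist_le _ (max a (min c (ℓ x)), 0) _ _
        ⟨⟨le_max_left _ _, max_le hac (min_le_left _ _)⟩, rfl⟩ ?_
      rw [Prod.dist_eq]
      refine max_le ?_ (by simpa using hx1.trans hκκ₀)
      rw [Real.dist_eq, abs_le]
      rcases le_total c (ℓ x) with h | h
      · rw [min_eq_left h, max_eq_right hac]
        exact ⟨by linarith, by linarith [hx2.2]⟩
      · rw [min_eq_right h]
        rcases le_total a (ℓ x) with h' | h'
        · rw [max_eq_right h']
          exact ⟨by linarith, by linarith⟩
        · rw [max_eq_left h']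
          exact ⟨by linarith [hx2.1], by linarith⟩
    simpa using hκ₀V hmem
  -- the push has full strength on the graph of `H` and fades out towards the side of the tube
  let lam : E → ℝ := fun x => max 0 (1 - ‖x - H (ℓ x)‖ / κ)
  have hlam0 : ∀ x, 0 ≤ lam x := fun x => le_max_left _ _
  have hlam1 : ∀ x, lam x ≤ 1 := fun x =>
    max_le zero_le_one (by linarith [div_nonneg (norm_nonneg (x - H (ℓ x))) hκpos.le])
  let ht : E → ℝ := fun x => ℓ x - lam x * pushAmount a c κ (ℓ x)
  let σ : E → E := fun x => x + H (ht x) - H (ℓ x)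
  have hσc : Continuous σ := by
    have := continuous_pushAmount a c κ
    fun_prop
  have hσℓ : ∀ x, ℓ (σ x) = ht x := fun x => by simp [σ, hℓH]
  have hσy : ∀ x, σ x - H (ℓ (σ x)) = x - H (ℓ x) := fun x => by
    rw [hσℓ]
    simp only [σ]
    abel
  have hσT : ∀ x ∉ T, σ x = x := by
    intro x hx
    have : lam x * pushAmount a c κ (ℓ x) = 0 := by
      by_cases h : ‖x - H (ℓ x)‖ ≤ κ
      · rw [pushAmount_eq_zero hac hκpos fun h' => hx ⟨h, h'⟩, mul_zero]
      · have : lam x = 0 := max_eq_left (by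
          rw [sub_nonpos, one_le_div hκpos]
          linarith)
        rw [this, zero_mul]
    simp [σ, ht, this]
  have hσTT : MapsTo σ T T := by
    rintro x ⟨hx1, hx2⟩
    have h1 := pushAmount_nonneg a c κ (ℓ x)
    refine ⟨by rwa [hσy], ?_⟩
    rw [hσℓ]
    constructor
    · have := le_sub_pushAmount (c := c) hx2.1
      simp only [ht]
      nlinarith [hlam1 x]
    · have := mul_nonneg (hlam0 x) h1
      simp only [ht]
      linarith [hx2.2]
  refine ⟨σ, hσc, fun x hx => hσT x fun h => hx (hT h).1, fun x hx => ?_, fun x hx => ?_⟩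
  · by_cases h : x ∈ T
    · exact (hT (hσTT h)).1
    · rwa [hσT x h]
  · obtain ⟨τ, hτ, hτx⟩ := hx
    by_cases h : x ∈ T
    · have hτI : τ ∈ Icc (0 : ℝ) 1 := ⟨hs0.trans hτ.1, hτ.2⟩
      have hτJ : τ ∈ J := by
        by_contra hcon
        refine (hT (hσTT h)).2 ⟨τ, ⟨hτI, fun h' => hcon ⟨hτI, h'.1.le, h'.2.le⟩⟩, hτx⟩
      have hy : x - H (ℓ x) = 0 := by rw [← hσy, ← hτx, hHγ τ hτJ, sub_self]
      have hl : lam x = 1 := by simp [lam, hy]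
      have hpa : a ≤ ℓ x - pushAmount a c κ (ℓ x) := by
        have h1 : ℓ (γ τ) = ht x := by rw [hτx, hσℓ]
        have h2 : a ≤ ℓ (γ τ) := hmono.monotoneOn hsJ hτJ hτ.1
        simp only [ht, hl, one_mul] at h1
        linarith
      have hpc : c ≤ ℓ x := by
        by_contra! hcon
        linarith [sub_pushAmount_lt hκpos hac hcon]
      obtain ⟨τ', hτ', h2⟩ := hivt t t' hst htt'.le le_rfl (ℓ x) ⟨hpc, h.2.2.trans hκt'⟩
      refine ⟨τ', ⟨hτ'.1, hτ'.2.trans ht'J.1.2⟩, ?_⟩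
      rw [sub_eq_zero.1 hy, ← h2, hHγ τ' (hJconv τ' ⟨hst.trans hτ'.1, hτ'.2⟩)]
    · rw [hσT x h] at hτx
      refine ⟨τ, ⟨?_, hτ.2⟩, hτx⟩
      by_contra! hτt
      have hτJ : τ ∈ J := hJconv τ ⟨hτ.1, (hτt.trans htt').le⟩
      refine h ?_
      rw [← hτx]
      refine ⟨by rw [hHγ τ hτJ, sub_self, norm_zero]; exact hκpos.le, ?_, ?_⟩
      · linarith [show a ≤ ℓ (γ τ) from hmono.monotoneOn hsJ hτJ hτ.1]
      · linarith [show ℓ (γ τ) ≤ c from hmono.monotoneOn hτJ htJ hτt.le]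

lemma IsTameArc.canPushOff [FiniteDimensional ℝ E] {γ : ℝ → E} (hγ : IsTameArc γ) {s t : ℝ}
    (hs : 0 ≤ s) (hst : s ≤ t) (ht : t < 1) : CanPushOff γ s t := by
  have hloc (x : Icc s t) := hγ.exists_canPushOff_near
    (t₀ := x) ⟨hs.trans x.2.1, x.2.2.trans ht.le⟩
  choose δ hδ h using hloc
  obtain ⟨u, hu0, hum, ⟨m, hm⟩, hu⟩ := exists_monotone_Icc_subset_open_cover_Icc hst
    (c := fun x : Icc s t => {y : Icc s t | (y : ℝ) ∈ Ioo (x - δ x) (x + δ x)})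
    (fun x => isOpen_Ioo.preimage continuous_subtype_val)
    (fun y _ => mem_iUnion.2 ⟨y, by have := hδ y; constructor <;> linarith⟩)
  have key : ∀ n, CanPushOff γ s (u n) := by
    intro n
    induction n with
    | zero => rw [hu0]; exact .refl γ s
    | succ n ih =>
      obtain ⟨x, hx⟩ := hu n
      have hle : u n ≤ u (n + 1) := hum n.le_succ
      exact ih.trans (u n).2.1 hle (h x _ _ (hx ⟨le_rfl, hle⟩) (hx ⟨hle, le_rfl⟩)
        (hs.trans (u n).2.1) hle ((u (n + 1)).2.2.trans_lt ht))
  have := key m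
  rwa [hm m le_rfl] at this

/-- A tame arc `γ` with its end point `γ 1` removed can be pushed off to the puncture: there is a
map of the complement of `γ 1` to the complement of the arc that is the identity off a given
neighbourhood `V` of the half-open arc. It is the composition of pushes along pieces
of the arc accumulating at `γ 1`, of which only finitely many matter near any other point. -/
lemma IsTameArc.exists_retraction [FiniteDimensional ℝ E] {γ : ℝ → E} (hγ : IsTameArc γ)
    {V : Set E} (hV : IsOpen V) (hVγ : γ '' Ico 0 1 ⊆ V) (hV1 : γ 1 ∉ V) :
    ∃ ρ : E → E, ContinuousOn ρ {γ 1}ᶜ ∧ (∀ x ∉ V, ρ x = x) ∧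
      MapsTo ρ V (V \ γ '' Icc 0 1) := by
  let t : ℕ → ℝ := fun n => 1 - 1 / ((n : ℝ) + 1)
  have ht0 : t 0 = 0 := by simp [t]
  have ht1 : ∀ n, t n < 1 := fun n => by
    have : 0 < 1 / ((n : ℝ) + 1) := Nat.one_div_pos_of_nat
    simp only [t]
    linarith
  have htm : Monotone t := fun m n hmn => by
    have := Nat.one_div_le_one_div (α := ℝ) hmn
    simp only [t]
    linarith
  have htpos : ∀ n, 0 ≤ t n := fun n => ht0 ▸ htm n.zero_le
  have hlim : Filter.Tendsto (fun n : ℕ => 1 / ((n : ℝ) + 1)) Filter.atTop (𝓝 0) :=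
    tendsto_one_div_add_atTop_nhds_zero_nat
  let W : ℕ → Set E := fun n =>
    V ∩ Metric.thickening (1 / ((n : ℝ) + 1)) (γ '' Icc (t n) (t (n + 1)))
  have hWV : ∀ n, W n ⊆ V := fun n => inter_subset_left
  have hσ (n : ℕ) := hγ.canPushOff (htpos n) (htm n.le_succ) (ht1 (n + 1)) (W n)
    (hV.inter Metric.isOpen_thickening)
    (subset_inter ((image_mono (Icc_subset_Ico_iff (htm n.le_succ) |>.2 ⟨htpos n, ht1 _⟩)).trans
      hVγ) (Metric.self_subset_thickening Nat.one_div_pos_of_nat _))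
  choose σ hσc hσW hσm hσγ using hσ
  -- the sets `W n` are locally finite away from `γ 1`
  have hfin : ∀ x, x ≠ γ 1 → ∃ N ∈ 𝓝 x, ∃ n₀, ∀ n ≥ n₀, Disjoint N (W n) := by
    intro x hx
    set d := dist x (γ 1) with hd
    have hdpos : 0 < d := dist_pos.2 hx
    have hc1 : ContinuousWithinAt γ (Icc 0 1) 1 := hγ.continuousOn 1 ⟨zero_le_one, le_rfl⟩
    obtain ⟨ε, hε, hε1⟩ := Metric.continuousWithinAt_iff.1 hc1 (d / 4) (by linarith)
    obtain ⟨n₀, hn₀⟩ := Filter.eventually_atTop.1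
      (hlim.eventually (gt_mem_nhds (lt_min hε (show 0 < d / 4 by linarith))))
    refine ⟨Metric.ball x (d / 4), Metric.ball_mem_nhds _ (by linarith), n₀, fun n hn => ?_⟩
    rw [Set.disjoint_left]
    rintro y hy ⟨-, hyW⟩
    obtain ⟨_, ⟨τ, hτ, rfl⟩, hyτ⟩ := Metric.mem_thickening_iff.1 hyW
    have h1 := lt_min_iff.1 (hn₀ n hn)
    have hτ1 : τ < 1 := hτ.2.trans_lt (ht1 _)
    have h2 : dist (γ τ) (γ 1) < d / 4 := by
      refine hε1 ⟨(htpos n).trans hτ.1, hτ1.le⟩ ?_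
      rw [Real.dist_eq, abs_sub_comm, abs_of_pos (by linarith)]
      have : 1 - 1 / ((n : ℝ) + 1) ≤ τ := hτ.1
      linarith
    have h3 := Metric.mem_ball'.1 hy
    have := dist_triangle4 x y (γ τ) (γ 1)
    linarith
  -- the partial compositions of the pushes
  let ρ : ℕ → E → E := fun n => Nat.rec id (fun k r => r ∘ σ k) n
  have hρs : ∀ n, ρ (n + 1) = ρ n ∘ σ n := fun n => rfl
  have hρc : ∀ n, Continuous (ρ n) := by
    intro n
    induction n with
    | zero => exact continuous_id
    | succ n ih => rw [hρs]; exact ih.comp (hσc n)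
  have hσV : ∀ n, MapsTo (σ n) V V := fun n x hx => by
    by_cases h : x ∈ W n
    · exact hWV n (hσm n h)
    · rwa [hσW n x h]
  have hρV : ∀ n, MapsTo (ρ n) V V := by
    intro n
    induction n with
    | zero => exact fun x hx => hx
    | succ n ih => rw [hρs]; exact ih.comp (hσV n)
  have hργ : ∀ n x, ρ n x ∈ γ '' Icc 0 1 → x ∈ γ '' Icc (t n) 1 := by
    intro n
    induction n with
    | zero => intro x hx; rwa [ht0]
    | succ n ih =>
      intro x hx
      exact hσγ n x (ih _ hx)
  have hρW : ∀ n₀ x, (∀ n ≥ n₀, x ∉ W n) → ∀ n ≥ n₀, ρ n x = ρ n₀ x := by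
    intro n₀ x hx n hn
    induction n, hn using Nat.le_induction with
    | base => rfl
    | succ n hn ih => rw [hρs, Function.comp_apply, hσW n x (hx n hn), ih]
  have hstab : ∀ x, ∃ n₀, x ≠ γ 1 → ∀ n ≥ n₀, ρ n x = ρ n₀ x := by
    intro x
    by_cases hx : x = γ 1
    · exact ⟨0, fun h => absurd hx h⟩
    · obtain ⟨N, hN, n₀, h⟩ := hfin x hx
      exact ⟨n₀, fun _ => hρW n₀ x fun n hn => Set.disjoint_left.1 (h n hn) (mem_of_mem_nhds hN)⟩
  -- `k x` is a stage from which on the partial compositions do not change at `x`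
  choose k hk using hstab
  have hlimρ : ∀ x, x ≠ γ 1 → ∀ n₀, (∀ n ≥ n₀, x ∉ W n) → ρ (k x) x = ρ n₀ x := by
    intro x hx n₀ h
    rw [← hk x hx _ (le_max_left (k x) n₀), hρW n₀ x h _ (le_max_right (k x) n₀)]
  refine ⟨fun x => ρ (k x) x, fun x hx => ?_, fun x hx => ?_, fun x hx => ⟨hρV _ hx, ?_⟩⟩
  · obtain ⟨N, hN, n₀, h⟩ := hfin x hx
    refine ((hρc n₀).continuousAt.congr ?_).continuousWithinAt
    filter_upwards [hN, isOpen_compl_singleton.mem_nhds hx] with y hy hy1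
    exact (hlimρ y hy1 n₀ fun n hn => Set.disjoint_left.1 (h n hn) hy).symm
  · have : ∀ n, ρ n x = x := fun n => by
      have := hρW 0 x (fun m _ h => hx (hWV m h)) n n.zero_le
      exact this
    exact this _
  · intro hmem
    have hx1 : x ≠ γ 1 := fun h => hV1 (h ▸ hx)
    have hn : ∀ n ≥ k x, x ∈ γ '' Icc (t n) 1 := fun n hn =>
      hργ n x (by rw [hk x hx1 n hn]; exact hmem)
    obtain ⟨τ, hτ, hτx⟩ := hn _ le_rfl
    have hτI : τ ∈ Icc (0 : ℝ) 1 := ⟨(htpos _).trans hτ.1, hτ.2⟩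
    have hτn : ∀ n ≥ k x, t n ≤ τ := fun n hnk => by
      obtain ⟨τ', hτ', h'⟩ := hn n hnk
      obtain rfl := hγ.injOn ⟨(htpos _).trans hτ'.1, hτ'.2⟩ hτI (h'.trans hτx.symm)
      exact hτ'.1
    have htlim : Filter.Tendsto t Filter.atTop (𝓝 1) := by
      simpa only [sub_zero] using hlim.const_sub 1
    have h1τ : 1 ≤ τ := le_of_tendsto htlim (Filter.eventually_atTop.2 ⟨k x, hτn⟩)
    exact hx1 (by rw [← hτx, le_antisymm hτ.2 h1τ])

end Arc

/-! ### Redundancy of singular arcs -/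

section Redundant

variable {n : ℕ} {M S B : Set (EuclideanSpace ℝ (Fin n))}

lemma relInterior_subset : relInterior M B ⊆ B :=
  fun _ hx => mem_of_mem_nhdsWithin hx.1 hx.2

lemma subset_relInterior {U : Set (EuclideanSpace ℝ (Fin n))} (hU : IsOpen U) (hUM : U ⊆ M)
    (hUB : U ⊆ B) : U ⊆ relInterior M B :=
  fun _ hx => ⟨hUM hx, mem_nhdsWithin_of_mem_nhds (Filter.mem_of_superset (hU.mem_nhds hx) hUB)⟩

lemma notMem_of_mem_manifoldBoundary {V : Set (EuclideanSpace ℝ (Fin n))} (hVM : V ⊆ interior M)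
    {x : EuclideanSpace ℝ (Fin n)} (hx : x ∈ manifoldBoundary M) : x ∉ V :=
  fun h => hx.2 (hVM h)

/-- Composition of a frame field with a map that pushes everything in `V` off the set `C`
containing the singularities in `V`. -/
lemma IsFrameField.continuousOn_comp {f : EuclideanSpace ℝ (Fin n) → FrameSpace n}
    (hf : IsFrameField M S f) {b : EuclideanSpace ℝ (Fin n)}
    {ρ : EuclideanSpace ℝ (Fin n) → EuclideanSpace ℝ (Fin n)}
    {V C N : Set (EuclideanSpace ℝ (Fin n))} (hρ : ContinuousOn ρ {b}ᶜ)
    (hρid : ∀ x ∉ V, ρ x = x) (hρV : MapsTo ρ V (V \ C)) (hVM : V ⊆ M) (hVS : V ∩ S ⊆ C)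
    (hN : S ∩ N ⊆ insert b V) : ContinuousOn (f ∘ ρ) ((M \ (S \ N)) \ {b}) := by
  refine ContinuousOn.comp hf (hρ.mono fun x hx => hx.2) fun x hx => ?_
  by_cases hxV : x ∈ V
  · have h := hρV hxV
    exact ⟨hVM h.1, fun hS => h.2 (hVS ⟨h.1, hS⟩)⟩
  · rw [hρid x hxV]
    refine ⟨hx.1.1, fun hS => ?_⟩
    have hxN : x ∈ N := by
      by_contra h
      exact hx.1.2 ⟨hS, h⟩
    exact (hN ⟨hS, hxN⟩).elim hx.2 hxV

/-- A half-open singular arc, whose missing end point is an accumulation point of other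
singularities, is redundant: the frame field can be composed with a map pushing the arc off to its
missing end point. -/
lemma isRedundantWithin_image_Ico {W V : Set (EuclideanSpace ℝ (Fin n))} (hSM : S ⊆ M)
    {f : EuclideanSpace ℝ (Fin n) → FrameSpace n} (hf : IsFrameField M S f)
    {γ : ℝ → EuclideanSpace ℝ (Fin n)} (hγ : IsTameArc γ) (hV : IsOpen V)
    (hVM : V ⊆ interior M) (hVS : V ∩ S = γ '' Ico 0 1) (hVW : insert (γ 1) V ⊆ W)
    (h1S : γ 1 ∈ S) (h1 : ∃ᶠ y in 𝓝[S] (γ 1), y ∉ insert (γ 1) V) :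
    IsRedundantWithin M S f (γ '' Ico 0 1) W := by
  have hγV : γ '' Ico 0 1 ⊆ V := hVS ▸ inter_subset_left
  have h1V : γ 1 ∉ V := by
    intro h
    obtain ⟨τ, hτ, h'⟩ : γ 1 ∈ γ '' Ico 0 1 := hVS ▸ ⟨h, h1S⟩
    obtain rfl := hγ.injOn ⟨hτ.1, hτ.2.le⟩ ⟨zero_le_one, le_rfl⟩ h'
    exact lt_irrefl _ hτ.2
  have hCc : IsClosed (γ '' Icc 0 1) :=
    (isCompact_Icc.image_of_continuousOn hγ.continuousOn).isClosed
  have hCne : (γ '' Icc 0 1).Nonempty := ⟨γ 1, mem_image_of_mem γ ⟨zero_le_one, le_rfl⟩⟩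
  have hVne : (Vᶜ).Nonempty := ⟨γ 1, h1V⟩
  -- a neighbourhood of the half-open arc that gets thinner towards the missing end point
  let B : Set (EuclideanSpace ℝ (Fin n)) :=
    {x | 2 * Metric.infDist x (γ '' Icc 0 1) ≤ Metric.infDist x Vᶜ}
  let V' : Set (EuclideanSpace ℝ (Fin n)) :=
    {x | 2 * Metric.infDist x (γ '' Icc 0 1) < Metric.infDist x Vᶜ}
  have hB : IsClosed B := isClosed_le ((Metric.continuous_infDist_pt _).const_mul 2)
    (Metric.continuous_infDist_pt _)
  have hV' : IsOpen V' := isOpen_lt ((Metric.continuous_infDist_pt _).const_mul 2)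
    (Metric.continuous_infDist_pt _)
  have hV'B : V' ⊆ B := fun x hx => by
    simp only [B, V', mem_ofPred_eq] at hx ⊢
    exact hx.le
  have hBV : B ⊆ insert (γ 1) V := by
    intro x hx
    simp only [B, mem_ofPred_eq] at hx
    by_cases hxV : x ∈ V
    · exact Or.inr hxV
    · rw [Metric.infDist_zero_of_mem (show x ∈ Vᶜ from hxV)] at hx
      have h0 : Metric.infDist x (γ '' Icc 0 1) = 0 :=
        le_antisymm (by linarith) Metric.infDist_nonneg
      obtain ⟨τ, hτ, rfl⟩ := (hCc.mem_iff_infDist_zero hCne).2 h0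
      rcases eq_or_lt_of_le hτ.2 with rfl | h
      · exact Or.inl rfl
      · exact absurd (hγV (mem_image_of_mem γ ⟨hτ.1, h⟩)) hxV
  have hV'V : V' ⊆ V := by
    intro x hx
    simp only [V', mem_ofPred_eq] at hx
    by_contra hxV
    rw [Metric.infDist_zero_of_mem (show x ∈ Vᶜ from hxV)] at hx
    linarith [Metric.infDist_nonneg (x := x) (s := γ '' Icc 0 1)]
  have hγV' : γ '' Ico 0 1 ⊆ V' := by
    intro x hx
    have h0 : Metric.infDist x (γ '' Icc 0 1) = 0 :=
      Metric.infDist_zero_of_mem (image_mono Ico_subset_Icc_self hx)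
    have : 0 < Metric.infDist x Vᶜ :=
      (hV.isClosed_compl.notMem_iff_infDist_pos hVne).1 fun h => h (hγV hx)
    simpa [V', h0] using this
  have h1B : γ 1 ∉ relInterior M B := fun h => h1 <| by
    filter_upwards [nhdsWithin_mono _ hSM h.2] with y hy using not_not.2 (hBV hy)
  obtain ⟨ρ, hρc, hρid, hρV⟩ := hγ.exists_retraction hV' hγV' fun h => h1V (hV'V h)
  have hV'M : V' ⊆ M := hV'V.trans (hVM.trans interior_subset)
  have hV'rel : V' ⊆ relInterior M B := subset_relInterior hV' hV'M hV'B
  have hrel : S ∩ relInterior M B ⊆ V' := fun x hx => by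
    rcases hBV (relInterior_subset hx.2) with rfl | h
    · exact absurd hx.2 h1B
    · exact hγV' (hVS ▸ ⟨h, hx.1⟩)
  refine ⟨B, f ∘ ρ, fun x hx => ⟨?_, hVW (hBV hx)⟩, hB.preimage continuous_subtype_val, ?_,
    hγV'.trans hV'rel, fun x hx => ?_, fun hal x hx => ?_⟩
  · rcases hBV hx with rfl | h
    · exact hSM h1S
    · exact interior_subset (hVM h)
  · refine (hf.continuousOn_comp hρc hρid hρV hV'M
      (fun x hx => image_mono Ico_subset_Icc_self (hVS ▸ ⟨hV'V hx.1, hx.2⟩))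
      (hrel.trans (subset_insert _ _))).mono fun x hx => ⟨hx, ?_⟩
    rintro rfl
    exact hx.2 ⟨h1S, h1B⟩
  · simp [hρid x fun h => hx.2 (hV'rel h)]
  · have hxV : x ∉ V' := fun h => notMem_of_mem_manifoldBoundary hVM hx.1 (hV'V h)
    have hxS : x ∉ S := fun h => by
      by_cases hxr : x ∈ relInterior M B
      · exact hxV (hrel ⟨h, hxr⟩)
      · exact hx.2 ⟨h, hxr⟩
    simpa [hρid x hxV] using hal x ⟨hx.1, hxS⟩

/-- An isolated closed singular arc of a `3`-frame field is redundant: pushing the arc off to one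
end point leaves a point singularity, which is removed by extending the field from a small
sphere around it to the ball. -/
lemma isRedundantWithin_image_Icc {M S W V : Set (EuclideanSpace ℝ (Fin 3))}
    {f : EuclideanSpace ℝ (Fin 3) → FrameSpace 3} (hf : IsFrameField M S f)
    {γ : ℝ → EuclideanSpace ℝ (Fin 3)} (hγ : IsTameArc γ) (hV : IsOpen V)
    (hVM : V ⊆ interior M) (hVS : V ∩ S = γ '' Icc 0 1) (hVW : V ⊆ W) :
    IsRedundantWithin M S f (γ '' Icc 0 1) W := by
  obtain ⟨K, hK, hγK, hKV⟩ := exists_compact_between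
    (isCompact_Icc.image_of_continuousOn hγ.continuousOn) hV (hVS ▸ inter_subset_left)
  have h1K : γ 1 ∈ interior K := hγK (mem_image_of_mem γ ⟨zero_le_one, le_rfl⟩)
  obtain ⟨r, hr, hrK⟩ := Metric.nhds_basis_closedBall.mem_iff.1 (isOpen_interior.mem_nhds h1K)
  have hKM : K ⊆ M := hKV.trans (hVM.trans interior_subset)
  -- `f ∘ ρ` is defined on the domain of the new field except at `γ 1`
  obtain ⟨ρ, hρc, hρid, hρV⟩ := hγ.exists_retraction (V := interior K \ {γ 1})
    (isOpen_interior.sdiff isClosed_singleton) (by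
      rintro _ ⟨τ, hτ, rfl⟩
      refine ⟨hγK (mem_image_of_mem γ ⟨hτ.1, hτ.2.le⟩), fun h => ?_⟩
      obtain rfl := hγ.injOn ⟨hτ.1, hτ.2.le⟩ ⟨zero_le_one, le_rfl⟩ h
      exact lt_irrefl _ hτ.2) (fun h => h.2 rfl)
  have hKrel : interior K ⊆ relInterior M K :=
    subset_relInterior isOpen_interior (interior_subset.trans hKM) interior_subset
  have hrel : S ∩ relInterior M K ⊆ interior K := fun x hx =>
    hγK (hVS ▸ ⟨hKV (relInterior_subset hx.2), hx.1⟩)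
  have hcont : ContinuousOn (f ∘ ρ) ((M \ (S \ relInterior M K)) \ {γ 1}) := by
    refine hf.continuousOn_comp hρc hρid hρV (sdiff_subset.trans (interior_subset.trans hKM))
      (fun x hx => hVS ▸ ⟨hKV (interior_subset hx.1.1), hx.2⟩) fun x hx => ?_
    by_cases h : x = γ 1
    · exact Or.inl h
    · exact Or.inr ⟨hrel hx, h⟩
  have hKdom : interior K ⊆ M \ (S \ relInterior M K) := fun x hx =>
    ⟨hKM (interior_subset hx), fun h => h.2 (hKrel hx)⟩
  obtain ⟨Φ, hΦ, hΦρ⟩ := exists_frame_extension_closedBall hr (hcont.mono fun x hx =>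
    ⟨hKdom (hrK (Metric.sphere_subset_closedBall hx)), Metric.ne_of_mem_sphere hx hr.ne'⟩)
  classical
  refine ⟨K, fun x => if x ∈ Metric.closedBall (γ 1) r then Φ x else (f ∘ ρ) x,
    fun x hx => ⟨hKM hx, hVW (hKV hx)⟩, hK.isClosed.preimage continuous_subtype_val, ?_,
    hγK.trans hKrel, fun x hx => ?_, fun hal x hx => ?_⟩
  · refine ContinuousOn.if (fun x hx => ?_) (hΦ.mono fun x hx => ?_) (hcont.mono fun x hx => ?_)
    · refine hΦρ ?_
      have := hx.2
      rwa [show {a | a ∈ Metric.closedBall (γ 1) r} = Metric.closedBall (γ 1) r from rfl,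
        frontier_closedBall _ hr.ne'] at this
    · have := hx.2
      rwa [show {a | a ∈ Metric.closedBall (γ 1) r} = Metric.closedBall (γ 1) r from rfl,
        Metric.isClosed_closedBall.closure_eq] at this
    · refine ⟨hx.1, ?_⟩
      rintro rfl
      have h2 : closure (Metric.closedBall (γ 1) r)ᶜ ⊆ (Metric.ball (γ 1) r)ᶜ :=
        closure_minimal (compl_subset_compl.2 Metric.ball_subset_closedBall)
          Metric.isOpen_ball.isClosed_compl
      exact h2 hx.2 (Metric.mem_ball_self hr)
  · have hxK : x ∉ interior K := fun h => hx.2 (hKrel h)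
    simp only [if_neg fun h => hxK (hrK h), Function.comp_apply, hρid x fun h => hxK h.1]
  · have hxV := notMem_of_mem_manifoldBoundary hVM hx.1
    have hxK : x ∉ interior K := fun h => hxV (hKV (interior_subset h))
    have hxS : x ∉ S := fun h => by
      by_cases hxr : x ∈ relInterior M K
      · exact hxK (hrel ⟨h, hxr⟩)
      · exact hx.2 ⟨h, hxr⟩
    simp only [if_neg fun h => hxK (hrK h), Function.comp_apply, hρid x fun h => hxK h.1]
    exact hal x ⟨hx.1, hxS⟩

end Redundant

/-! ### Branches of singularity graphs -/

namespace SingularityGraph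

variable {n : ℕ} {S : Set (EuclideanSpace ℝ (Fin n))} {ι : Type*} (G : SingularityGraph S ι)

lemma isTameArc_edge (e : ι) : IsTameArc (G.edge e) :=
  isTameArc_of_contDiffOn ((G.contDiffOn_edge e).of_le (by exact_mod_cast le_top)) (G.injOn_edge e)
    (G.derivWithin_edge_ne_zero e)

lemma isClosed_closedEdge (e : ι) : IsClosed (G.closedEdge e) :=
  (isCompact_Icc.image_of_continuousOn (G.contDiffOn_edge e).continuousOn).isClosed

lemma closedEdge_subset_carrier (e : ι) : G.closedEdge e ⊆ G.carrier :=
  (subset_iUnion G.closedEdge e).trans subset_union_right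

variable {G} in
lemma mem_image_Ioo_of_notMem_vertices {e : ι} {x : EuclideanSpace ℝ (Fin n)}
    (hx : x ∈ G.closedEdge e) (hxv : x ∉ G.vertices) : x ∈ G.edge e '' Ioo 0 1 := by
  obtain ⟨t, ht, rfl⟩ := hx
  refine ⟨t, ⟨lt_of_le_of_ne ht.1 ?_, lt_of_le_of_ne ht.2 ?_⟩, rfl⟩
  · rintro rfl
    exact hxv (G.edge_zero_mem e)
  · rintro rfl
    exact hxv (G.edge_one_mem e)

variable {G} in
/-- A point of a branch lies on no other edge. -/
lemma eq_of_mem_closedEdge {e e' : ι} {x : EuclideanSpace ℝ (Fin n)} (hx : x ∈ G.closedEdge e)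
    (hx' : x ∈ G.closedEdge e') (hxl : ¬(x ∈ G.vertices ∧ ¬G.IsLeaf x)) : e' = e := by
  by_cases hxv : x ∈ G.vertices
  · have hleaf : G.IsLeaf x := by
      by_contra h
      exact hxl ⟨hxv, h⟩
    exact hleaf.2.unique hx' hx
  · by_contra h
    exact Set.disjoint_left.1 (G.disjoint_edges e' e h) (mem_image_Ioo_of_notMem_vertices hx' hxv)
      (mem_image_Ioo_of_notMem_vertices hx hxv)

/-- A branch is relatively open in the singularity set. -/
lemma branch_union_compl_mem_nhds {O : Set (EuclideanSpace ℝ (Fin n))} (hO : IsOpen O)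
    (hSO : S ∩ O = G.carrier) (e : ι) {x : EuclideanSpace ℝ (Fin n)}
    (hx : x ∈ G.closedEdge e \ {v | v ∈ G.vertices ∧ ¬G.IsLeaf v}) :
    (G.closedEdge e \ {v | v ∈ G.vertices ∧ ¬G.IsLeaf v}) ∪ Sᶜ ∈ 𝓝 x := by
  have hxc := G.closedEdge_subset_carrier e hx.1
  obtain ⟨U, hU, hUv, hUe⟩ := G.locally_finite x hxc
  have hOx : O ∈ 𝓝 x := hO.mem_nhds (hSO ▸ hxc : x ∈ S ∩ O).2
  have h1 : ((G.vertices ∩ U) \ {x})ᶜ ∈ 𝓝 x :=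
    (hUv.subset sdiff_subset).isClosed.isOpen_compl.mem_nhds fun h => h.2 rfl
  have h2 : (⋃ e' ∈ {e' | (G.closedEdge e' ∩ U).Nonempty} \ {e}, G.closedEdge e')ᶜ ∈ 𝓝 x := by
    refine (Set.Finite.isClosed_biUnion (hUe.subset sdiff_subset)
      fun e' _ => G.isClosed_closedEdge e').isOpen_compl.mem_nhds fun h => ?_
    obtain ⟨e', he', hxe'⟩ := mem_iUnion₂.1 h
    exact he'.2 (eq_of_mem_closedEdge hx.1 hxe' hx.2)
  filter_upwards [hU, hOx, h1, h2] with y hyU hyO hy1 hy2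
  by_cases hyS : y ∈ S
  · left
    by_cases hyx : y = x
    · rwa [hyx]
    have hyv : y ∉ G.vertices := fun h => hy1 ⟨⟨h, hyU⟩, hyx⟩
    have hyc : y ∈ G.carrier := hSO ▸ ⟨hyS, hyO⟩
    obtain ⟨e', hye'⟩ := mem_iUnion.1 (hyc.resolve_left hyv)
    refine ⟨?_, fun h => hyv h.1⟩
    by_cases he : e' = e
    · rwa [← he]
    · exact absurd (mem_iUnion₂.2 ⟨e', ⟨⟨y, hye', hyU⟩, he⟩, hye'⟩) hy2
  · exact Or.inr hyS

/-- An edge with a leaf has a tame parametrization starting at a leaf. -/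
lemma exists_isTameArc_of_isLeaf {e : ι} {v : EuclideanSpace ℝ (Fin n)} (hv : v ∈ G.closedEdge e)
    (hvl : G.IsLeaf v) : ∃ γ : ℝ → EuclideanSpace ℝ (Fin n), IsTameArc γ ∧
      γ '' Icc 0 1 = G.closedEdge e ∧ G.IsLeaf (γ 0) ∧ γ 1 ∈ G.vertices ∧
      γ '' Ioo 0 1 ⊆ G.edge e '' Ioo 0 1 := by
  obtain ⟨t, ht, rfl⟩ := hv
  have ht01 : t = 0 ∨ t = 1 := by
    by_contra! h
    exact Set.disjoint_left.1 (G.disjoint_vertices e)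
      ⟨t, ⟨lt_of_le_of_ne ht.1 h.1.symm, lt_of_le_of_ne ht.2 h.2⟩, rfl⟩ hvl.1
  rcases ht01 with rfl | rfl
  · exact ⟨G.edge e, G.isTameArc_edge e, rfl, hvl, G.edge_one_mem e, subset_rfl⟩
  · refine ⟨fun t => G.edge e (1 - t), (G.isTameArc_edge e).reverse, ?_, by simpa using hvl,
      by simpa using G.edge_zero_mem e, ?_⟩
    · rw [closedEdge, ← image_image (G.edge e) fun t : ℝ => 1 - t]
      simp
    · rw [← image_image (G.edge e) fun t : ℝ => 1 - t]
      simp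

variable {G} in
/-- At a vertex of an edge that is not a leaf, singularities outside of that edge accumulate. -/
lemma frequently_notMem_closedEdge {e : ι} {b : EuclideanSpace ℝ (Fin n)}
    (hb : b ∈ G.closedEdge e) (hbv : b ∈ G.vertices) (hbl : ¬G.IsLeaf b) :
    ∃ᶠ y in 𝓝[S] b, y ∉ G.closedEdge e := by
  obtain ⟨e', hbe', hne⟩ : ∃ e', b ∈ G.closedEdge e' ∧ e' ≠ e := by
    by_contra! h
    exact hbl ⟨hbv, e, hb, h⟩
  obtain ⟨t, ht, rfl⟩ := hbe'
  have hcont : Filter.Tendsto (G.edge e') (𝓝[Ioo 0 1] t) (𝓝[S] (G.edge e' t)) :=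
    tendsto_nhdsWithin_of_tendsto_nhds_of_eventually_within _
      (((G.contDiffOn_edge e').continuousOn t ht).mono Ioo_subset_Icc_self)
      (eventually_mem_nhdsWithin.mono fun τ hτ =>
        G.edge_subset e' (mem_image_of_mem _ (Ioo_subset_Icc_self hτ)))
  have : (𝓝[Ioo (0 : ℝ) 1] t).NeBot := by
    rw [← mem_closure_iff_nhdsWithin_neBot, closure_Ioo zero_ne_one]
    exact ht
  refine hcont.frequently (Filter.Eventually.frequently ?_)
  refine eventually_mem_nhdsWithin.mono fun τ hτ hmem => ?_
  have hτ' : G.edge e' τ ∈ G.edge e' '' Ioo 0 1 := mem_image_of_mem _ hτ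
  exact Set.disjoint_left.1 (G.disjoint_edges e' e hne) hτ'
    (mem_image_Ioo_of_notMem_vertices hmem
      (Set.disjoint_left.1 (G.disjoint_vertices e') hτ'))

end SingularityGraph

theorem mainTheorem11 {ι : Type*} (M S : Set (EuclideanSpace ℝ (Fin 3)))
    (hM : IsSmoothDomain M) (hSM : S ⊆ M)
    (f : EuclideanSpace ℝ (Fin 3) → FrameSpace 3) (hf : IsFrameField M S f)
    (G : SingularityGraph S ι)
    (hG : ∃ O : Set (EuclideanSpace ℝ (Fin 3)), IsOpen O ∧ S ∩ O = G.carrier)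
    (L : Set (EuclideanSpace ℝ (Fin 3))) (hL : G.IsBranch L)
    (hLM : Disjoint L (manifoldBoundary M)) :
    IsRedundant M S f L ∧
      ∀ W : Set (EuclideanSpace ℝ (Fin 3)), IsOpen W → closure L ⊆ W →
        IsRedundantWithin M S f L W := by
  suffices h : ∀ W : Set (EuclideanSpace ℝ (Fin 3)), IsOpen W → closure L ⊆ W →
      IsRedundantWithin M S f L W from ⟨h univ isOpen_univ (subset_univ _), h⟩
  intro W hW hLW
  obtain ⟨O, hO, hSO⟩ := hG
  obtain ⟨e, ⟨v, hv, hvl⟩, hLe⟩ := hL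
  obtain ⟨γ, hγ, hγe, hγ0, hγ1, hγI⟩ := G.exists_isTameArc_of_isLeaf hv hvl
  have h1e : γ 1 ∈ G.closedEdge e := hγe ▸ mem_image_of_mem γ ⟨zero_le_one, le_rfl⟩
  have hLS : L ⊆ S := hLe ▸ sdiff_subset.trans (G.edge_subset e)
  have hLint : L ⊆ interior M := fun x hx => by
    by_contra h
    exact Set.disjoint_left.1 hLM hx ⟨hSM (hLS hx), h⟩
  -- an open neighbourhood of the branch inside `W` without other singularities
  set V := interior (L ∪ Sᶜ) ∩ (interior M ∩ W) with hVdef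
  have hV : IsOpen V := isOpen_interior.inter (isOpen_interior.inter hW)
  have hVS : V ∩ S = L := by
    refine Subset.antisymm (fun x hx => ?_) fun x hx => ⟨⟨?_, hLint hx, hLW (subset_closure hx)⟩,
      hLS hx⟩
    · exact (interior_subset hx.1.1).resolve_right fun h => h hx.2
    · rw [mem_interior_iff_mem_nhds, hLe]
      exact G.branch_union_compl_mem_nhds hO hSO e (hLe ▸ hx)
  have hVM : V ⊆ interior M := fun x hx => hx.2.1
  have hVW : V ⊆ W := fun x hx => hx.2.2
  have hIco : γ '' Ico 0 1 ⊆ L := by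
    rintro _ ⟨t, ht, rfl⟩
    rw [hLe]
    refine ⟨hγe ▸ mem_image_of_mem γ ⟨ht.1, ht.2.le⟩, fun h => ?_⟩
    rcases eq_or_lt_of_le ht.1 with rfl | h0
    · exact h.2 hγ0
    · exact Set.disjoint_left.1 (G.disjoint_vertices e)
        (hγI (mem_image_of_mem γ ⟨h0, ht.2⟩)) h.1
  by_cases hleaf : G.IsLeaf (γ 1)
  · have hLγ : L = γ '' Icc 0 1 := by
      refine Subset.antisymm (by rw [hLe, hγe]; exact sdiff_subset) ?_
      rintro _ ⟨t, ht, rfl⟩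
      rcases eq_or_lt_of_le ht.2 with rfl | h
      · rw [hLe]
        exact ⟨h1e, fun h => h.2 hleaf⟩
      · exact hIco (mem_image_of_mem γ ⟨ht.1, h⟩)
    rw [hLγ] at hVS ⊢
    exact isRedundantWithin_image_Icc hf hγ hV hVM hVS hVW
  · have h1L : γ 1 ∉ L := by
      rw [hLe]
      exact fun h => h.2 ⟨hγ1, hleaf⟩
    have hLγ : L = γ '' Ico 0 1 := by
      refine Subset.antisymm (fun x hx => ?_) hIco
      obtain ⟨t, ht, rfl⟩ : x ∈ γ '' Icc 0 1 := by
        rw [hγe]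
        exact (hLe ▸ hx :
          x ∈ G.closedEdge e \ {v | v ∈ G.vertices ∧ ¬G.IsLeaf v}).1
      refine mem_image_of_mem γ ⟨ht.1, lt_of_le_of_ne ht.2 ?_⟩
      rintro rfl
      exact h1L hx
    have h1W : γ 1 ∈ W := by
      refine hLW ?_
      have h1 : (1 : ℝ) ∈ closure (Ico 0 1) := by
        rw [closure_Ico zero_ne_one]
        exact ⟨zero_le_one, le_rfl⟩
      rw [hLγ]
      exact ((hγ.continuousOn 1 ⟨zero_le_one, le_rfl⟩).mono
        Ico_subset_Icc_self).mem_closure_image h1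
    have hfreq : ∃ᶠ y in 𝓝[S] (γ 1), y ∉ insert (γ 1) V := by
      refine ((SingularityGraph.frequently_notMem_closedEdge h1e hγ1 hleaf).and_eventually
        eventually_mem_nhdsWithin).mono ?_
      rintro y ⟨hy, hyS⟩ (rfl | hyV)
      · exact hy h1e
      · have hyL : y ∈ L := hVS ▸ ⟨hyV, hyS⟩
        rw [hLe] at hyL
        exact hy hyL.1
    rw [hLγ] at hVS ⊢
    exact isRedundantWithin_image_Ico hSM hf hγ hV hVM hVS (insert_subset h1W hVW)
      (G.vertices_subset hγ1) hfreq
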